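/- Let $\alpha\ge 0$ be real, let $k\ge 1$ be an integer, and consider the linear ordinary differential equation $$EQ:\qquad a_k y^{(k)}+a_{k-1}y^{(k-1)}+\dots+a_0y=0,\qquad a_0,\dots,a_k\in\mathbb C,\ a_k\neq 0 .$$ Suppose that any two distinct roots of its characteristic polynomial $a_kX^k+\dots+a_1X+a_0$ have distinct real parts. Then there is a finite number $\sharp(EQ,\alpha)$, depending only on $\alpha$ and the equation, with the following two properties. 1. Every solution $y:\mathbb C\to\mathbb C$ of $EQ$ that is not identically zero has at most $\sharp(EQ,\alpha)$ zeros, counted with multiplicities, in the horizontal strip $\Pi_\alpha=\{z\in\mathbb C: |\operatorname{Im} z|\le\alpha\}$. 2. If all characteristic roots $\lambda_1,\dots,\lambda_k$ are simple, numbered so that $\operatorname{Re}\lambda_1<\operatorname{Re}\lambda_2<\dots<\operatorname{Re}\lambda_k$, then $$\sharp(EQ,\alpha)\le (k-1)^2+\frac{2}{\pi}(k-1)\,\mathcal L(EQ)\,\bigl[\alpha(\Xi+2)+\Theta\log 4\bigr],$$ where $\mathcal L(EQ)$ is the length of the shortest polygonal path in $\mathbb C$ passing through all the $\lambda_j$,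 and $$\Theta=\max_{1\le j\le k-1}\bigl|\operatorname{Re}\lambda_j-\operatorname{Re}\lambda_{j+1}\bigr|^{-1},\qquad \Xi=\max_{1\le j\le k-1}\left|\frac{\operatorname{Im}\lambda_j-\operatorname{Im}\lambda_{j+1}}{\operatorname{Re}\lambda_j-\operatorname{Re}\lambda_{j+1}}\right|$$ (both maxima are taken to be $0$ if $k=1$). -/

import Mathlib

open Polynomial

noncomputable section

/-- The characteristic polynomial `∑ a_j X ^ j` of the equation `∑ a_j y^(j) = 0`, `0 ≤ j ≤ k`. -/
def odeCharPoly {k : ℕ} (a : Fin (k + 1) → ℂ) : ℂ[X] :=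
  ∑ j : Fin (k + 1), C (a j) * X ^ (j : ℕ)

/-- `y` is an (entire) solution of `a_k y^(k) + ⋯ + a_1 y' + a_0 y = 0`. -/
def IsODESolution {k : ℕ} (a : Fin (k + 1) → ℂ) (y : ℂ → ℂ) : Prop :=
  Differentiable ℂ y ∧ ∀ z, ∑ j : Fin (k + 1), a j * iteratedDeriv (j : ℕ) y z = 0

/-- The closed horizontal strip `|Im z| ≤ α`. -/
def horizontalStrip (α : ℝ) : Set ℂ := {z | |z.im| ≤ α}

/-- The number of zeros of the analytic function `y` in `U`, counted with multiplicity: the sum over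
all `z ∈ U` of the order of vanishing of `y` at `z`, as the supremum of the finite partial sums. It
is `⊤` if there are infinitely many zeros. -/
def zeroCount (y : ℂ → ℂ) (U : Set ℂ) : ℕ∞ :=
  ⨆ (S : Finset ℂ) (_ : (S : Set ℂ) ⊆ U), ∑ z ∈ S, analyticOrderAt y z

/-- The set of points on the polygonal path with the given consecutive vertices. -/
def polygonalTrace : List ℂ → Set ℂ
  | [] => ∅
  | [z] => {z}
  | z :: w :: l => segment ℝ z w ∪ polygonalTrace (w :: l)

/-- The length of the polygonal path with the given consecutive vertices. -/
def polygonalLength : List ℂ → ℝ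
  | [] => 0
  | [_] => 0
  | z :: w :: l => dist z w + polygonalLength (w :: l)

/-- The length of the shortest polygonal path that passes through all points of `Λ`. -/
def shortestPathLength (Λ : Set ℂ) : ℝ :=
  sInf {ℓ | ∃ p : List ℂ, Λ ⊆ polygonalTrace p ∧ ℓ = polygonalLength p}

/-- `Θ = max_j |Re λ_j - Re λ_{j+1}|⁻¹` over consecutive indices (`0` if there are none). -/
def rootTheta {k : ℕ} (lam : Fin k → ℂ) : ℝ :=
  ⨆ j : Fin (k - 1),
    |(lam ⟨j, by omega⟩).re - (lam ⟨j + 1, by omega⟩).re|⁻¹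

/-- `Ξ = max_j |(Im λ_j - Im λ_{j+1}) / (Re λ_j - Re λ_{j+1})|` over consecutive indices
(`0` if there are none). -/
def rootXi {k : ℕ} (lam : Fin k → ℂ) : ℝ :=
  ⨆ j : Fin (k - 1),
    |((lam ⟨j, by omega⟩).im - (lam ⟨j + 1, by omega⟩).im) /
      ((lam ⟨j, by omega⟩).re - (lam ⟨j + 1, by omega⟩).re)|

end

/-! Along a segment of direction u put q = u f'/f; then q + q'/q = u f''/f'. Since Im q is the speed
of arg f, comparing it with the growth of |arg q| yields a Rolle inequality for the variation V of
the argument along the boundary of a rectangle: V(f) ≤ V(f') + 2π, the 2π coming from the four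
corners (`rectVariation_le_deriv`). Multiplying by e^{cz} costs at most |c| times the perimeter.

A solution f is annihilated by the product of the operators d/dz - λ over the characteristic roots,
in any order. Differentiating e^{-μz} f gives e^{-μz}(f' - μf), and exchanging e^{-μz} for e^{-νz}
prepares the next factor; a round costs 2π + |μ - ν|·perimeter. After at most k - 1 rounds a
constant remains. Hence V is at most 2π(k - 1) plus the perimeter times the length of the path
through the roots in the chosen order, and the argument principle bounds the zeros in a rectangle
(`sum_order_le_of_applyFactors_eq_zero`). For simple roots the order can be taken nearly optimal
(`exists_list_polygonalLength_lt`).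

It remains to confine the zeros in the strip to boundedly many rectangles. Solutions are exponential
polynomials, and at a zero no term can outweigh all the others together. For simple roots this
forces zeros near the at most k - 1 abscissas where the dominant exponential changes
(`exists_cover_zeros_of_simple`). In general a zero is near a root of a coefficient polynomial, or
two terms are comparable there, which for a given pair happens only in a window of bounded width
(`exists_cover_zeros`). The widths do not depend on the solution, so the bounds are uniform. -/

/-! ### Growth of the unsigned angle along a curve. -/

section AngleRolle

open Complex Set Filter Topology

theorem abs_arg_mul_le {a b : ℂ} (ha : a ≠ 0) (hb : b ≠ 0) : |arg (a * b)| ≤ |arg a| + |arg b| := by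
  have h := InnerProductGeometry.angle_le_angle_add_angle (a * b) b 1
  rw [Complex.angle_eq_abs_arg (mul_ne_zero ha hb) one_ne_zero,
    Complex.angle_eq_abs_arg (mul_ne_zero ha hb) hb, Complex.angle_eq_abs_arg hb one_ne_zero] at h
  simpa [hb] using h

/-- The jump of `arg` across the negative axis is between π and -π, hence invisible to |arg|, which
is the angle with 1. -/
theorem continuousAt_abs_arg_of_ne_zero {z : ℂ} (hz : z ≠ 0) : ContinuousAt (fun w => |arg w|) z := by
  have h : ContinuousAt (fun w : ℂ => InnerProductGeometry.angle w 1) z :=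
    (InnerProductGeometry.continuousAt_angle (x := (z, (1 : ℂ))) hz one_ne_zero).comp
      (f := fun w : ℂ => (w, (1 : ℂ))) (by fun_prop)
  refine h.congr ?_
  filter_upwards [isOpen_ne.mem_nhds hz] with w hw
  rw [Complex.angle_eq_abs_arg hw one_ne_zero, div_one]

theorem hasDerivAt_arg_comp {q : ℝ → ℂ} {q' : ℂ} {x : ℝ} (hq : HasDerivAt q q' x)
    (h : q x ∈ slitPlane) : HasDerivAt (fun t => arg (q t)) (q' / q x).im x := by
  have h1 := hq.clog_real h
  have h2 := (Complex.imCLM.hasFDerivAt.comp_hasDerivAt x h1)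
  simpa [Function.comp_def, Complex.log_im] using h2

/-- The unsigned angle of `q t` with the positive real axis grows at most at the rate
`|Im q + Im (q' / q)| - |Im q|`. -/
theorem eventually_slope_abs_arg_lt {q : ℝ → ℂ} {q' : ℂ} {x : ℝ} (hq : HasDerivAt q q' x)
    (h0 : q x ≠ 0) {r : ℝ} (hr : |(q x).im + (q' / q x).im| - |(q x).im| < r) :
    ∀ᶠ z in 𝓝[>] x, slope (fun t => |arg (q t)|) x z < r := by
  have hc : ContinuousAt q x := hq.continuousAt
  have key : ∀ {g : ℝ → ℝ} {g' : ℝ}, HasDerivAt g g' x → g' < r →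
      ∀ᶠ z in 𝓝[>] x, slope g x z < r := by
    intro g g' hg hlt
    have := (hasDerivAt_iff_tendsto_slope.1 hg).mono_left
      (nhdsWithin_mono x (fun y (hy : x < y) => hy.ne'))
    exact this.eventually (gt_mem_nhds hlt)
  rcases lt_trichotomy (q x).im 0 with h | h | h
  · have h1 := (hasDerivAt_arg_comp hq (Or.inr h.ne)).neg
    have h2 : HasDerivAt (fun t => |arg (q t)|) (-(q' / q x).im) x := by
      refine h1.congr_of_eventuallyEq ?_
      have : ∀ᶠ t in 𝓝 x, (q t).im < 0 :=
        (Complex.continuous_im.continuousAt.comp hc).eventually (gt_mem_nhds h)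
      filter_upwards [this] with t ht
      simp [abs_of_neg (Complex.arg_neg_iff.2 ht)]
    refine key h2 (lt_of_le_of_lt ?_ hr)
    rw [abs_of_neg h]
    linarith [neg_le_abs ((q x).im + (q' / q x).im)]
  -- Here q x may be a negative real, where `arg` is not differentiable. Dividing by q x moves the
  -- point to 1, and subadditivity of |arg| transfers the estimate back.
  · have hd : HasDerivAt (fun t => q t / q x) (q' / q x) x := hq.div_const _
    have h1 := hasDerivAt_arg_comp hd (by simp [h0])
    simp only [div_self h0, div_one] at h1
    have h2 := ((hasDerivAt_iff_tendsto_slope.1 h1).mono_left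
      (nhdsWithin_mono x (fun y (hy : x < y) => hy.ne'))).abs
    rw [h] at hr
    have h3 := h2.eventually (gt_mem_nhds (by simpa using hr : |(q' / q x).im| < r))
    have h4 : ∀ᶠ t in 𝓝[>] x, q t ≠ 0 :=
      (hc.eventually (isOpen_ne.mem_nhds h0)).filter_mono nhdsWithin_le_nhds
    filter_upwards [h3, h4, self_mem_nhdsWithin] with z hz hz0 (hxz : x < z)
    refine lt_of_le_of_lt ?_ hz
    have hpos : 0 < z - x := sub_pos.2 hxz
    have h5 := abs_arg_mul_le (div_ne_zero hz0 h0) h0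
    rw [div_mul_cancel₀ _ h0] at h5
    rw [slope_def_field, slope_def_field, abs_div, abs_of_pos hpos]
    have : |arg (q z)| - |arg (q x)| ≤ |arg (q z / q x) - arg (q x / q x)| := by
      rw [div_self h0, arg_one, sub_zero]; linarith
    gcongr
  · have h1 := hasDerivAt_arg_comp hq (Or.inr h.ne')
    have h2 : HasDerivAt (fun t => |arg (q t)|) (q' / q x).im x := by
      refine h1.congr_of_eventuallyEq ?_
      have : ∀ᶠ t in 𝓝 x, 0 < (q t).im :=
        (Complex.continuous_im.continuousAt.comp hc).eventually (lt_mem_nhds h)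
      filter_upwards [this] with t ht
      simp [abs_of_nonneg (Complex.arg_nonneg_iff.2 ht.le)]
    refine key h2 (lt_of_le_of_lt ?_ hr)
    rw [abs_of_pos h]
    linarith [le_abs_self ((q x).im + (q' / q x).im)]

theorem abs_arg_sub_le_integral {q q' : ℝ → ℂ} {ℓ : ℝ} (hℓ : 0 ≤ ℓ)
    (hq : ∀ t, HasDerivAt q (q' t) t) (hq' : Continuous q') (h0 : ∀ t, q t ≠ 0) :
    |arg (q ℓ)| - |arg (q 0)| ≤
      (∫ t in (0 : ℝ)..ℓ, |(q t).im + (q' t / q t).im|) - ∫ t in (0 : ℝ)..ℓ, |(q t).im| := by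
  have hqc : Continuous q := continuous_iff_continuousAt.2 fun t => (hq t).continuousAt
  have hr : Continuous fun t => q' t / q t := hq'.div hqc h0
  have hi1 : Continuous fun t => |(q t).im + (q' t / q t).im| :=
    ((Complex.continuous_im.comp hqc).add (Complex.continuous_im.comp hr)).abs
  have hi2 : Continuous fun t => |(q t).im| := (Complex.continuous_im.comp hqc).abs
  have hi := hi1.sub hi2
  have hder : ∀ x, HasDerivAt
      (fun s => |arg (q 0)| + ∫ t in (0 : ℝ)..s, (|(q t).im + (q' t / q t).im| - |(q t).im|))
      (|(q x).im + (q' x / q x).im| - |(q x).im|) x := fun x =>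
    (intervalIntegral.integral_hasDerivAt_right (hi.intervalIntegrable _ _)
      (hi.stronglyMeasurableAtFilter _ _) hi.continuousAt).const_add _
  have := image_le_of_liminf_slope_right_le_deriv_boundary (a := 0) (b := ℓ)
    (f := fun t => |arg (q t)|)
    (fun x _ => ((continuousAt_abs_arg_of_ne_zero (h0 x)).comp
      (hqc.continuousAt (x := x))).continuousWithinAt)
    (by simp) (fun x _ => (hder x).continuousAt.continuousWithinAt)
    (fun x _ => (hder x).hasDerivWithinAt)
    (fun x _ r hr => (eventually_slope_abs_arg_lt (hq x) (h0 x) hr).frequently)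
    (right_mem_Icc.2 hℓ)
  rw [intervalIntegral.integral_sub (hi1.intervalIntegrable _ _) (hi2.intervalIntegrable _ _)]
    at this
  linarith

end AngleRolle

/-! ### Rolle's theorem for the variation of the argument. -/

section Variation

open Complex Set

/-- Total variation of the argument of `f` along the segment from `z` of direction `u`. -/
noncomputable def edgeVariation (f : ℂ → ℂ) (z u : ℂ) (ℓ : ℝ) : ℝ :=
  ∫ t in (0 : ℝ)..ℓ, |(u * logDeriv f (z + t * u)).im|

/-- Total variation of the argument of `f` along the boundary of the rectangle with lower left
corner `z`, width `w` and height `h`. -/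
noncomputable def rectVariation (f : ℂ → ℂ) (z : ℂ) (w h : ℝ) : ℝ :=
  edgeVariation f z 1 w + edgeVariation f (z + w) I h +
    edgeVariation f (z + w + h * I) (-1) w + edgeVariation f (z + h * I) (-I) h

/-- The union of the four lines that carry the sides of a rectangle. -/
def rectLines (z : ℂ) (w h : ℝ) : Set ℂ :=
  {ζ | ζ.re = z.re ∨ ζ.re = z.re + w ∨ ζ.im = z.im ∨ ζ.im = z.im + h}

theorem continuous_logDeriv_edge {f : ℂ → ℂ} (hf : Differentiable ℂ f) {z u : ℂ}
    (h0 : ∀ t : ℝ, f (z + t * u) ≠ 0) : Continuous fun t : ℝ => logDeriv f (z + t * u) := by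
  have h1 : Continuous f := hf.continuous
  have h2 : Continuous (deriv f) := hf.deriv.continuous
  simp only [logDeriv_apply]
  exact (h2.comp (by fun_prop)).div (h1.comp (by fun_prop)) h0

/-- This is `abs_arg_sub_le_integral` for q = u f'/f along the edge, where q + q'/q = u f''/f'. The
endpoint angles are kept so that they can cancel between consecutive edges. -/
theorem edgeVariation_le_deriv {f : ℂ → ℂ} (hf : Differentiable ℂ f) {z u : ℂ} {ℓ : ℝ}
    (hℓ : 0 ≤ ℓ) (hu : u ≠ 0) (h0 : ∀ t : ℝ, f (z + t * u) ≠ 0)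
    (h1 : ∀ t : ℝ, deriv f (z + t * u) ≠ 0) :
    edgeVariation f z u ℓ ≤ edgeVariation (deriv f) z u ℓ +
      |arg (u * logDeriv f z)| - |arg (u * logDeriv f (z + ℓ * u))| := by
  have hd : ∀ t : ℝ, HasDerivAt (fun t : ℝ => z + t * u) u t := fun t => by
    simpa using ((Complex.ofRealCLM.hasDerivAt (x := t)).mul_const u).const_add z
  have hq : ∀ t : ℝ, HasDerivAt (fun t : ℝ => u * logDeriv f (z + t * u))
      (u * ((deriv (deriv f) (z + t * u) * u * f (z + t * u) -
        deriv f (z + t * u) * (deriv f (z + t * u) * u)) / f (z + t * u) ^ 2)) t := fun t => by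
    have ha := (hf (z + t * u)).hasDerivAt.comp t (hd t)
    have hb := (hf.deriv (z + t * u)).hasDerivAt.comp t (hd t)
    exact (hb.div ha (h0 t)).const_mul u
  have c0 : Continuous fun t : ℝ => f (z + t * u) := hf.continuous.comp (by fun_prop)
  have c1 : Continuous fun t : ℝ => deriv f (z + t * u) := hf.deriv.continuous.comp (by fun_prop)
  have c2 : Continuous fun t : ℝ => deriv (deriv f) (z + t * u) :=
    hf.deriv.deriv.continuous.comp (by fun_prop)
  have := abs_arg_sub_le_integral hℓ hq
    (continuous_const.mul (((c2.mul continuous_const).mul c0 |>.sub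
      (c1.mul (c1.mul continuous_const))).div (c0.pow 2) fun t => pow_ne_zero 2 (h0 t)))
    (fun t => mul_ne_zero hu (div_ne_zero (h1 t) (h0 t)))
  have e : ∀ t : ℝ, (u * logDeriv f (z + t * u)).im +
      (u * ((deriv (deriv f) (z + t * u) * u * f (z + t * u) -
        deriv f (z + t * u) * (deriv f (z + t * u) * u)) / f (z + t * u) ^ 2) /
        (u * logDeriv f (z + t * u))).im = (u * logDeriv (deriv f) (z + t * u)).im := by
    intro t
    rw [← Complex.add_im, logDeriv_apply, logDeriv_apply]
    congr 1
    have hA := h0 t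
    have hB := h1 t
    generalize f (z + t * u) = A at *
    generalize deriv f (z + t * u) = B at *
    field_simp
    ring
  simp only [e] at this
  simp only [ofReal_zero, zero_mul, add_zero] at this
  unfold edgeVariation
  linarith

theorem edgeVariation_exp_mul_le {f : ℂ → ℂ} (hf : Differentiable ℂ f) {z u : ℂ} {ℓ : ℝ}
    (hℓ : 0 ≤ ℓ) (hu : ‖u‖ = 1) (h0 : ∀ t : ℝ, f (z + t * u) ≠ 0) (c : ℂ) :
    edgeVariation (fun ζ => exp (c * ζ) * f ζ) z u ℓ ≤ ‖c‖ * ℓ + edgeVariation f z u ℓ := by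
  have hL := continuous_logDeriv_edge hf h0
  have e : ∀ t : ℝ, logDeriv (fun ζ => exp (c * ζ) * f ζ) (z + t * u) =
      c + logDeriv f (z + t * u) := fun t => by
    have hE : HasDerivAt (fun ζ => exp (c * ζ)) (exp (c * (z + t * u)) * c) (z + t * u) := by
      simpa using ((hasDerivAt_id (z + t * u)).const_mul c).cexp
    rw [logDeriv_mul (f := fun ζ => exp (c * ζ)) _ (exp_ne_zero _) (h0 t) hE.differentiableAt (hf _), logDeriv_apply, hE.deriv,
      mul_div_cancel_left₀ _ (exp_ne_zero _)]
  unfold edgeVariation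
  simp only [e]
  have hc : ∫ _ in (0 : ℝ)..ℓ, ‖c‖ = ‖c‖ * ℓ := by simp [mul_comm]
  rw [← hc, ← intervalIntegral.integral_add]
  · apply intervalIntegral.integral_mono_on hℓ
    · exact (by fun_prop : Continuous _).intervalIntegrable _ _
    · exact (by fun_prop : Continuous _).intervalIntegrable _ _
    · intro t _
      rw [mul_add, add_im]
      refine (abs_add_le _ _).trans (add_le_add_left ?_ _)
      refine (Complex.abs_im_le_norm _).trans ?_
      rw [norm_mul, hu, one_mul]
  · exact (by fun_prop : Continuous _).intervalIntegrable _ _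
  · exact (by fun_prop : Continuous _).intervalIntegrable _ _

/-- At a corner the direction turns from u to iu, so the endpoint angles of adjacent edges cancel up
to π/2. -/
theorem abs_arg_corner_le {u p : ℂ} (hu : u ≠ 0) (hp : p ≠ 0) :
    |arg (I * u * p)| ≤ |arg (u * p)| + Real.pi / 2 := by
  have := abs_arg_mul_le I_ne_zero (mul_ne_zero hu hp)
  rw [arg_I, abs_of_pos Real.pi_div_two_pos, ← mul_assoc] at this
  linarith

theorem edges_mem_rectLines (z : ℂ) (w h t : ℝ) :
    z + t * 1 ∈ rectLines z w h ∧ z + w + t * I ∈ rectLines z w h ∧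
      z + w + h * I + t * (-1) ∈ rectLines z w h ∧ z + h * I + t * (-I) ∈ rectLines z w h := by
  simp [rectLines]

/-- Rolle's theorem for the variation of the argument along the boundary of a rectangle. -/
theorem rectVariation_le_deriv {f : ℂ → ℂ} (hf : Differentiable ℂ f) {z : ℂ} {w h : ℝ}
    (hw : 0 ≤ w) (hh : 0 ≤ h) (h0 : ∀ ζ ∈ rectLines z w h, f ζ ≠ 0)
    (h1 : ∀ ζ ∈ rectLines z w h, deriv f ζ ≠ 0) :
    rectVariation f z w h ≤ rectVariation (deriv f) z w h + 2 * Real.pi := by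
  have hm := edges_mem_rectLines z w h
  have e1 := edgeVariation_le_deriv hf hw one_ne_zero (fun t => h0 _ (hm t).1)
    (fun t => h1 _ (hm t).1)
  have e2 := edgeVariation_le_deriv hf hh I_ne_zero (fun t => h0 _ (hm t).2.1)
    (fun t => h1 _ (hm t).2.1)
  have e3 := edgeVariation_le_deriv hf hw (neg_ne_zero.2 one_ne_zero)
    (fun t => h0 _ (hm t).2.2.1) (fun t => h1 _ (hm t).2.2.1)
  have e4 := edgeVariation_le_deriv hf hh (neg_ne_zero.2 I_ne_zero)
    (fun t => h0 _ (hm t).2.2.2) (fun t => h1 _ (hm t).2.2.2)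
  have hL : ∀ ζ ∈ rectLines z w h, logDeriv f ζ ≠ 0 := fun ζ hζ =>
    div_ne_zero (h1 ζ hζ) (h0 ζ hζ)
  have c1 := abs_arg_corner_le (u := 1) one_ne_zero (hL (z + w) (by simp [rectLines]))
  have c2 := abs_arg_corner_le (u := I) I_ne_zero (hL (z + w + h * I) (by simp [rectLines]))
  have c3 := abs_arg_corner_le (u := -1) (neg_ne_zero.2 one_ne_zero)
    (hL (z + h * I) (by simp [rectLines]))
  have c4 := abs_arg_corner_le (u := -I) (neg_ne_zero.2 I_ne_zero) (hL z (by simp [rectLines]))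
  have p1 : z + w * 1 = z + w := by ring
  have p3 : z + w + h * I + w * (-1) = z + h * I := by ring
  have p4 : z + h * I + h * (-I) = z := by ring
  rw [p1] at e1
  rw [p3] at e3
  rw [p4] at e4
  rw [mul_one I] at c1
  rw [I_mul_I] at c2
  rw [mul_neg_one] at c3
  rw [mul_neg, I_mul_I, neg_neg] at c4
  unfold rectVariation
  linarith

theorem rectVariation_exp_mul_le {f : ℂ → ℂ} (hf : Differentiable ℂ f) {z : ℂ} {w h : ℝ}
    (hw : 0 ≤ w) (hh : 0 ≤ h) (h0 : ∀ ζ ∈ rectLines z w h, f ζ ≠ 0) (c : ℂ) :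
    rectVariation (fun ζ => exp (c * ζ) * f ζ) z w h ≤
      ‖c‖ * (2 * w + 2 * h) + rectVariation f z w h := by
  have hm := edges_mem_rectLines z w h
  have e1 := edgeVariation_exp_mul_le hf hw (by simp) (fun t => h0 _ (hm t).1) c
  have e2 := edgeVariation_exp_mul_le hf hh (by simp) (fun t => h0 _ (hm t).2.1) c
  have e3 := edgeVariation_exp_mul_le hf hw (by simp) (fun t => h0 _ (hm t).2.2.1) c
  have e4 := edgeVariation_exp_mul_le hf hh (by simp) (fun t => h0 _ (hm t).2.2.2) c
  unfold rectVariation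
  linarith

end Variation

/-! ### The argument principle on rectangles. -/

section ArgumentPrinciple

open Complex Set

/-- The integral of `g` along the segment from `z` of direction `u`. -/
noncomputable def edgeIntegral (g : ℂ → ℂ) (z u : ℂ) (ℓ : ℝ) : ℂ :=
  ∫ t in (0 : ℝ)..ℓ, u * g (z + t * u)

/-- The integral of `g` along the boundary of the rectangle with lower left corner `z`, width `w`
and height `h`. -/
noncomputable def rectIntegral (g : ℂ → ℂ) (z : ℂ) (w h : ℝ) : ℂ :=
  edgeIntegral g z 1 w + edgeIntegral g (z + w) I h +
    edgeIntegral g (z + w + h * I) (-1) w + edgeIntegral g (z + h * I) (-I) h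

/-- The closed rectangle with lower left corner `z`, width `w` and height `h`. -/
def closedRect (z : ℂ) (w h : ℝ) : Set ℂ :=
  Icc z.re (z.re + w) ×ℂ Icc z.im (z.im + h)

/-- The open rectangle with lower left corner `z`, width `w` and height `h`. -/
def openRect (z : ℂ) (w h : ℝ) : Set ℂ :=
  Ioo z.re (z.re + w) ×ℂ Ioo z.im (z.im + h)

theorem edgeIntegral_im_le_edgeVariation {f : ℂ → ℂ} (hf : Differentiable ℂ f) {z u : ℂ} {ℓ : ℝ}
    (hℓ : 0 ≤ ℓ) (h0 : ∀ t : ℝ, f (z + t * u) ≠ 0) :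
    (edgeIntegral (logDeriv f) z u ℓ).im ≤ edgeVariation f z u ℓ := by
  have hL : Continuous fun t : ℝ => u * logDeriv f (z + t * u) :=
    continuous_const.mul (continuous_logDeriv_edge hf h0)
  have h1 := Complex.imCLM.intervalIntegral_comp_comm (hL.intervalIntegrable (μ := MeasureTheory.volume) 0 ℓ)
  simp only [imCLM_apply] at h1
  unfold edgeIntegral edgeVariation
  rw [← h1]
  exact intervalIntegral.integral_mono_on hℓ
    ((Complex.continuous_im.comp hL).intervalIntegrable _ _)
    ((Complex.continuous_im.comp hL).abs.intervalIntegrable _ _) fun t _ => le_abs_self _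

theorem rectIntegral_im_le_rectVariation {f : ℂ → ℂ} (hf : Differentiable ℂ f) {z : ℂ} {w h : ℝ}
    (hw : 0 ≤ w) (hh : 0 ≤ h) (h0 : ∀ ζ ∈ rectLines z w h, f ζ ≠ 0) :
    (rectIntegral (logDeriv f) z w h).im ≤ rectVariation f z w h := by
  have hm := edges_mem_rectLines z w h
  have e1 := edgeIntegral_im_le_edgeVariation hf hw (fun t => h0 _ (hm t).1)
  have e2 := edgeIntegral_im_le_edgeVariation hf hh (fun t => h0 _ (hm t).2.1)
  have e3 := edgeIntegral_im_le_edgeVariation hf hw (fun t => h0 _ (hm t).2.2.1)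
  have e4 := edgeIntegral_im_le_edgeVariation hf hh (fun t => h0 _ (hm t).2.2.2)
  unfold rectVariation rectIntegral
  simp only [add_im]
  linarith

theorem rectIntegral_eq_zero {g : ℂ → ℂ} {z : ℂ} {w h : ℝ} (hw : 0 ≤ w) (hh : 0 ≤ h)
    (hg : DifferentiableOn ℂ g (closedRect z w h)) : rectIntegral g z w h = 0 := by
  have H := Complex.integral_boundary_rect_eq_zero_of_differentiableOn g z (z + w + h * I) (by
    simpa [closedRect, uIcc_of_le (le_add_of_nonneg_right hw : z.re ≤ z.re + w),
      uIcc_of_le (le_add_of_nonneg_right hh : z.im ≤ z.im + h)] using hg)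
  simp only [add_re, ofReal_re, mul_re, I_re, mul_zero, ofReal_im, I_im, mul_one, sub_self,
    add_zero, add_im, mul_im, smul_eq_mul] at H
  have hz : (z.re : ℂ) + z.im * I = z := re_add_im z
  have i1 : edgeIntegral g z 1 w = ∫ x : ℝ in z.re..z.re + w, g (x + z.im * I) := by
    have := intervalIntegral.integral_comp_add_left (a := 0) (b := w)
      (fun x : ℝ => g (x + z.im * I)) z.re
    rw [add_zero] at this
    rw [← this]
    refine intervalIntegral.integral_congr fun t _ => ?_
    simp only [one_mul, mul_one]
    congr 1
    push_cast
    linear_combination -hz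
  have i2 : edgeIntegral g (z + w) I h =
      I * ∫ y : ℝ in z.im..z.im + h, g ((z.re + w : ℝ) + y * I) := by
    have := intervalIntegral.integral_comp_add_left (a := 0) (b := h)
      (fun y : ℝ => g ((z.re + w : ℝ) + y * I)) z.im
    rw [add_zero] at this
    rw [← this, ← intervalIntegral.integral_const_mul]
    refine intervalIntegral.integral_congr fun t _ => ?_
    congr 2
    push_cast
    linear_combination -hz
  have i3 : edgeIntegral g (z + w + h * I) (-1) w =
      -∫ x : ℝ in z.re..z.re + w, g (x + (z.im + h : ℝ) * I) := by
    have := intervalIntegral.integral_comp_sub_left (a := 0) (b := w)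
      (fun x : ℝ => g (x + (z.im + h : ℝ) * I)) (z.re + w)
    rw [sub_zero, add_sub_cancel_right] at this
    rw [← this, ← intervalIntegral.integral_neg]
    refine intervalIntegral.integral_congr fun t _ => ?_
    simp only [neg_one_mul]
    congr 2
    push_cast
    linear_combination -hz
  have i4 : edgeIntegral g (z + h * I) (-I) h =
      -(I * ∫ y : ℝ in z.im..z.im + h, g (z.re + y * I)) := by
    have := intervalIntegral.integral_comp_sub_left (a := 0) (b := h)
      (fun y : ℝ => g (z.re + y * I)) (z.im + h)
    rw [sub_zero, add_sub_cancel_right] at this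
    rw [← this, ← neg_mul, ← intervalIntegral.integral_const_mul]
    refine intervalIntegral.integral_congr fun t _ => ?_
    congr 2
    push_cast
    linear_combination -hz
  unfold rectIntegral
  rw [i1, i2, i3, i4]
  linear_combination H

/-- The hypothesis puts a to the left of the edge. Then (ζ - a)/u stays in the lower half plane,
where the principal logarithm is a primitive without branch problems. -/
theorem edgeIntegral_inv_sub_im {z u a : ℂ} {ℓ : ℝ} (hu : u ≠ 0) (ha : ((z - a) / u).im < 0) :
    (edgeIntegral (fun ζ => (ζ - a)⁻¹) z u ℓ).im =
      arg ((z + ℓ * u - a) / u) - arg ((z - a) / u) := by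
  have e : ∀ t : ℝ, (z + t * u - a) / u = (z - a) / u + t := fun t => by field_simp; ring
  have him : ∀ t : ℝ, ((z - a) / u + t : ℂ).im < 0 := fun t => by simpa using ha
  have hd : ∀ t : ℝ, HasDerivAt (fun t : ℝ => Complex.log ((z - a) / u + t))
      (u * (z + t * u - a)⁻¹) t := fun t => by
    have h1 : HasDerivAt (fun t : ℝ => (z - a) / u + (t : ℂ)) 1 t :=
      (Complex.ofRealCLM.hasDerivAt (x := t)).const_add _
    have h2 := h1.clog_real (Or.inr (him t).ne)
    convert h2 using 1
    rw [← e, one_div_div, div_eq_mul_inv]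
  have hc : Continuous fun t : ℝ => u * (z + t * u - a)⁻¹ := by
    refine continuous_const.mul (Continuous.inv₀ (by fun_prop) fun t ht => ?_)
    have h := him t
    rw [← e, ht, zero_div] at h
    exact lt_irrefl _ h
  unfold edgeIntegral
  rw [intervalIntegral.integral_eq_sub_of_hasDerivAt (fun t _ => hd t)
    (hc.intervalIntegrable _ _), sub_im, log_im, log_im, e, ofReal_zero, add_zero]

theorem arg_neg_I_mul {p : ℂ} (hre : 0 < p.re) (him : p.im < 0) :
    arg (-I * p) = arg p - Real.pi / 2 := by
  have hp : p ≠ 0 := fun h => by simp [h] at hre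
  have h1 := abs_lt.1 (Complex.abs_arg_lt_pi_div_two_iff.2 (Or.inl hre))
  have h2 := Complex.arg_neg_iff.2 him
  rw [Complex.arg_mul (neg_ne_zero.2 I_ne_zero) hp, arg_neg_I]
  · ring
  · rw [arg_neg_I]
    constructor <;> linarith [Real.pi_pos]

/-- Each edge contributes a difference of angles measured relative to its own direction. The sum
telescopes around the boundary except for the change of direction at the corners, which adds π/2
four times. -/
theorem rectIntegral_inv_sub_im {z a : ℂ} {w h : ℝ} (ha : a ∈ openRect z w h) :
    (rectIntegral (fun ζ => (ζ - a)⁻¹) z w h).im = 2 * Real.pi := by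
  obtain ⟨⟨ha1, ha2⟩, ⟨ha3, ha4⟩⟩ := ha
  have q1 := arg_neg_I_mul (p := z + w - a) (by simpa using ha2) (by simpa using ha3)
  have q2 := arg_neg_I_mul (p := -I * (z + w + h * I - a)) (by simpa using ha4)
    (by simpa using ha2)
  have q3 := arg_neg_I_mul (p := -(z + h * I - a)) (by simpa using ha1) (by simpa using ha4)
  have q4 := arg_neg_I_mul (p := I * (z - a)) (by simpa using ha3) (by simpa using ha1)
  have d1 : ∀ x : ℂ, x / I = -I * x := fun x => by simp [mul_comm]
  have d2 : ∀ x : ℂ, x / (-1) = -x := fun x => by simp [div_neg]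
  have d3 : ∀ x : ℂ, x / (-I) = I * x := fun x => by simp [div_neg, mul_comm]
  have e1 := edgeIntegral_inv_sub_im (z := z) (u := 1) (a := a) (ℓ := w) one_ne_zero
    (by simpa using ha3)
  have e2 := edgeIntegral_inv_sub_im (z := z + w) (u := I) (a := a) (ℓ := h) I_ne_zero
    (by rw [d1]; simpa using ha2)
  have e3 := edgeIntegral_inv_sub_im (z := z + w + h * I) (u := -1) (a := a) (ℓ := w)
    (neg_ne_zero.2 one_ne_zero) (by rw [d2]; simpa using ha4)
  have e4 := edgeIntegral_inv_sub_im (z := z + h * I) (u := -I) (a := a) (ℓ := h)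
    (neg_ne_zero.2 I_ne_zero) (by rw [d3]; simpa using ha1)
  rw [div_one, div_one, mul_one] at e1
  rw [d1, d1, q1] at e2
  rw [d2, d2, show -(z + w + h * I - a) = -I * (-I * (z + w + h * I - a)) by
    rw [← mul_assoc, neg_mul_neg, I_mul_I]; ring, q2,
    show z + w + h * I + w * (-1) - a = z + h * I - a by ring] at e3
  rw [d3, d3, show I * (z + h * I - a) = -I * -(z + h * I - a) by ring, q3,
    show z + h * I + h * (-I) - a = z - a by ring] at e4
  rw [← mul_assoc, neg_mul, I_mul_I, neg_neg, one_mul] at q4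
  rw [q4] at e1
  unfold rectIntegral
  simp only [add_im]
  rw [e1, e2, e3, e4]
  ring

theorem edgeIntegral_add {f g : ℂ → ℂ} {z u : ℂ} (ℓ : ℝ)
    (hf : Continuous fun t : ℝ => f (z + t * u)) (hg : Continuous fun t : ℝ => g (z + t * u)) :
    edgeIntegral (fun ζ => f ζ + g ζ) z u ℓ = edgeIntegral f z u ℓ + edgeIntegral g z u ℓ := by
  unfold edgeIntegral
  simp only [mul_add]
  exact intervalIntegral.integral_add ((continuous_const.mul hf).intervalIntegrable _ _)
    ((continuous_const.mul hg).intervalIntegrable _ _)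

theorem edgeIntegral_congr {f g : ℂ → ℂ} {z u : ℂ} (ℓ : ℝ)
    (h : ∀ t : ℝ, f (z + t * u) = g (z + t * u)) :
    edgeIntegral f z u ℓ = edgeIntegral g z u ℓ := by
  unfold edgeIntegral
  simp only [h]

theorem edgeIntegral_logDeriv_sub_mul {f : ℂ → ℂ} (hf : Differentiable ℂ f) {z u a : ℂ} (ℓ : ℝ)
    (ha : ∀ t : ℝ, z + t * u - a ≠ 0) (h0 : ∀ t : ℝ, f (z + t * u) ≠ 0) :
    edgeIntegral (logDeriv fun ζ => (ζ - a) * f ζ) z u ℓ =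
      edgeIntegral (fun ζ => (ζ - a)⁻¹) z u ℓ + edgeIntegral (logDeriv f) z u ℓ := by
  rw [← edgeIntegral_add (f := fun ζ => (ζ - a)⁻¹) ℓ (Continuous.inv₀ (by fun_prop) ha) (continuous_logDeriv_edge hf h0)]
  refine edgeIntegral_congr ℓ fun t => ?_
  rw [logDeriv_mul (f := fun ζ => ζ - a) _ (ha t) (h0 t) (by fun_prop) (hf _), logDeriv_apply]
  simp

theorem sub_ne_zero_of_mem_rectLines {z a ζ : ℂ} {w h : ℝ} (ha : a ∈ openRect z w h)
    (hζ : ζ ∈ rectLines z w h) : ζ - a ≠ 0 := by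
  obtain ⟨⟨ha1, ha2⟩, ⟨ha3, ha4⟩⟩ := ha
  intro h0
  rw [sub_eq_zero] at h0
  subst h0
  rcases hζ with h | h | h | h
  · exact ha1.ne' h
  · exact ha2.ne h
  · exact ha3.ne' h
  · exact ha4.ne h

theorem rectIntegral_logDeriv_sub_mul {f : ℂ → ℂ} (hf : Differentiable ℂ f) {z a : ℂ} {w h : ℝ}
    (ha : a ∈ openRect z w h) (h0 : ∀ ζ ∈ rectLines z w h, f ζ ≠ 0) :
    rectIntegral (logDeriv fun ζ => (ζ - a) * f ζ) z w h =
      rectIntegral (fun ζ => (ζ - a)⁻¹) z w h + rectIntegral (logDeriv f) z w h := by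
  have hm := edges_mem_rectLines z w h
  have hs : ∀ ζ ∈ rectLines z w h, ζ - a ≠ 0 := fun ζ hζ => sub_ne_zero_of_mem_rectLines ha hζ
  unfold rectIntegral
  rw [edgeIntegral_logDeriv_sub_mul hf w (fun t => hs _ (hm t).1) (fun t => h0 _ (hm t).1),
    edgeIntegral_logDeriv_sub_mul hf h (fun t => hs _ (hm t).2.1) (fun t => h0 _ (hm t).2.1),
    edgeIntegral_logDeriv_sub_mul hf w (fun t => hs _ (hm t).2.2.1) (fun t => h0 _ (hm t).2.2.1),
    edgeIntegral_logDeriv_sub_mul hf h (fun t => hs _ (hm t).2.2.2) (fun t => h0 _ (hm t).2.2.2)]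
  ring

theorem analyticOrderAt_ne_top_of_entire {f : ℂ → ℂ} (hf : Differentiable ℂ f) (h : f ≠ 0)
    (z : ℂ) : analyticOrderAt f z ≠ ⊤ := by
  intro htop
  rw [analyticOrderAt_eq_top] at htop
  have hA : AnalyticOnNhd ℂ f univ := fun x _ => hf.analyticAt x
  exact h (funext fun x =>
    hA.eqOn_zero_of_preconnected_of_eventuallyEq_zero isPreconnected_univ (mem_univ z) htop
      (mem_univ x))

theorem exists_entire_eq_sub_mul {f : ℂ → ℂ} (hf : Differentiable ℂ f) {a : ℂ} (ha : f a = 0) :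
    ∃ g : ℂ → ℂ, Differentiable ℂ g ∧ f = fun ζ => (ζ - a) * g ζ := by
  refine ⟨dslope f a, ?_, ?_⟩
  · rw [← differentiableOn_univ,
      Complex.differentiableOn_dslope (Filter.univ_mem)]
    exact hf.differentiableOn
  · funext ζ
    have := sub_smul_dslope f a ζ
    rw [ha, sub_zero, smul_eq_mul] at this
    exact this.symm

theorem analyticOrderNatAt_sub_mul {g : ℂ → ℂ} (hg : Differentiable ℂ g) (h : g ≠ 0) (a z : ℂ) :
    analyticOrderNatAt (fun ζ => (ζ - a) * g ζ) z =
      (if z = a then 1 else 0) + analyticOrderNatAt g z := by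
  have h1 : AnalyticAt ℂ (fun ζ : ℂ => ζ - a) z := by fun_prop
  have h2 : analyticOrderAt (fun ζ : ℂ => ζ - a) z = if z = a then 1 else 0 := by
    split_ifs with hz
    · subst hz
      exact analyticOrderAt_id_sub_const_self
    · exact analyticOrderAt_id_sub_const_of_ne hz
  have h3 : analyticOrderNatAt (fun ζ : ℂ => ζ - a) z = if z = a then 1 else 0 := by
    unfold analyticOrderNatAt
    rw [h2]
    split_ifs <;> simp
  have := analyticOrderNatAt_mul h1 (hg.analyticAt z) (by rw [h2]; split_ifs <;> simp)
    (analyticOrderAt_ne_top_of_entire hg h z)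
  rw [h3] at this
  exact this

/-- The argument principle on a rectangle. -/
theorem rectIntegral_logDeriv_im {z : ℂ} {w h : ℝ} (hw : 0 ≤ w) (hh : 0 ≤ h) {T : Finset ℂ}
    (hT : ∀ a ∈ T, a ∈ openRect z w h) (n : ℕ) {f : ℂ → ℂ} (hf : Differentiable ℂ f)
    (h0 : ∀ ζ ∈ rectLines z w h, f ζ ≠ 0) (hz : ∀ ζ ∈ closedRect z w h, f ζ = 0 → ζ ∈ T)
    (hn : ∑ a ∈ T, analyticOrderNatAt f a = n) :
    (rectIntegral (logDeriv f) z w h).im = 2 * Real.pi * n := by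
  -- Induction on the total multiplicity: each step splits off one factor ζ - a, worth 2π, until the
  -- logarithmic derivative is holomorphic. The set T stays fixed while zeros disappear from it.
  induction n generalizing f with
  | zero =>
    have hne : f ≠ 0 := fun hf0 => h0 z (by simp [rectLines]) (by simp [hf0])
    have hnz : ∀ ζ ∈ closedRect z w h, f ζ ≠ 0 := by
      intro ζ hζ hfζ
      have h1 := (Finset.sum_eq_zero_iff.1 hn) ζ (hz ζ hζ hfζ)
      have h2 : analyticOrderAt f ζ = 0 := by
        rw [← Nat.cast_analyticOrderNatAt (analyticOrderAt_ne_top_of_entire hf hne ζ), h1]; rfl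
      exact ((hf.analyticAt ζ).analyticOrderAt_eq_zero.1 h2) hfζ
    rw [rectIntegral_eq_zero hw hh]
    · simp
    · exact hf.deriv.differentiableOn.div hf.differentiableOn hnz
  | succ n ih =>
    obtain ⟨a, haT, ha⟩ := Finset.exists_ne_zero_of_sum_ne_zero (hn.trans_ne n.succ_ne_zero)
    obtain ⟨g, hg, rfl⟩ := exists_entire_eq_sub_mul hf (apply_eq_zero_of_analyticOrderNatAt_ne_zero ha)
    have hg0 : ∀ ζ ∈ rectLines z w h, g ζ ≠ 0 := fun ζ hζ => right_ne_zero_of_mul (h0 ζ hζ)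
    have hne : g ≠ 0 := fun hf0 => hg0 z (by simp [rectLines]) (by simp [hf0])
    rw [rectIntegral_logDeriv_sub_mul hg (hT a haT) hg0, add_im,
      rectIntegral_inv_sub_im (hT a haT), ih hg hg0 (fun ζ hζ h => hz ζ hζ (by simp [h]))]
    · push_cast; ring
    · simp only [analyticOrderNatAt_sub_mul hg hne, Finset.sum_add_distrib,
        Finset.sum_ite_eq', if_pos haT] at hn
      omega

theorem finite_zeros_closedRect {f : ℂ → ℂ} (hf : Differentiable ℂ f) (h : f ≠ 0) (z : ℂ)
    (w h' : ℝ) : (closedRect z w h' ∩ f ⁻¹' {0}).Finite := by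
  have hK : IsCompact (closedRect z w h') := isCompact_Icc.reProdIm isCompact_Icc
  by_contra hinf
  obtain ⟨x, -, hx⟩ := Set.Infinite.exists_accPt_of_subset_isCompact hinf hK inter_subset_left
  have hA : AnalyticOnNhd ℂ f univ := fun x _ => hf.analyticAt x
  refine h (funext fun y => hA.eqOn_zero_of_preconnected_of_frequently_eq_zero
    isPreconnected_univ (mem_univ x) ?_ (mem_univ y))
  rw [accPt_iff_frequently_nhdsNE] at hx
  exact hx.mono fun y hy => hy.2

theorem two_pi_mul_sum_order_le_rectVariation {z : ℂ} {w h : ℝ} (hw : 0 ≤ w) (hh : 0 ≤ h)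
    {f : ℂ → ℂ} (hf : Differentiable ℂ f) (h0 : ∀ ζ ∈ rectLines z w h, f ζ ≠ 0) {S : Finset ℂ}
    (hS : (S : Set ℂ) ⊆ closedRect z w h) :
    2 * Real.pi * (∑ a ∈ S, analyticOrderNatAt f a : ℕ) ≤ rectVariation f z w h := by
  have hne : f ≠ 0 := fun hf0 => h0 z (by simp [rectLines]) (by simp [hf0])
  have hfin := finite_zeros_closedRect hf hne z w h
  have hT : ∀ a ∈ hfin.toFinset, a ∈ openRect z w h := by
    intro a ha
    obtain ⟨⟨⟨h1, h2⟩, h3, h4⟩, h5⟩ := hfin.mem_toFinset.1 ha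
    have h6 : a ∉ rectLines z w h := fun hmem => h0 a hmem h5
    simp only [rectLines, mem_ofPred_eq, not_or] at h6
    exact ⟨⟨lt_of_le_of_ne h1 (Ne.symm h6.1), lt_of_le_of_ne h2 h6.2.1⟩,
      lt_of_le_of_ne h3 (Ne.symm h6.2.2.1), lt_of_le_of_ne h4 h6.2.2.2⟩
  have h1 := rectIntegral_logDeriv_im hw hh hT _ hf h0
    (fun ζ hζ h => hfin.mem_toFinset.2 ⟨hζ, h⟩) rfl
  have h2 := rectIntegral_im_le_rectVariation hf hw hh h0
  rw [h1] at h2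
  refine le_trans ?_ h2
  have h3 : ∑ a ∈ S, analyticOrderNatAt f a ≤ ∑ a ∈ hfin.toFinset, analyticOrderNatAt f a := by
    refine Finset.sum_le_sum_of_ne_zero fun a ha h => ?_
    exact hfin.mem_toFinset.2 ⟨hS ha, apply_eq_zero_of_analyticOrderNatAt_ne_zero h⟩
  gcongr

end ArgumentPrinciple

/-! ### Zeros in a rectangle of a function killed by first-order factors. -/

section Annihilator

open Complex Set

/-- Apply successively the operators `d/dz - μ`, with `μ` running through the list. -/
noncomputable def applyFactors : List ℂ → (ℂ → ℂ) → (ℂ → ℂ)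
  | [], f => f
  | μ :: l, f => applyFactors l fun ζ => deriv f ζ - μ * f ζ

theorem countable_zeros_of_entire {f : ℂ → ℂ} (hf : Differentiable ℂ f) (h : f ≠ 0) :
    (f ⁻¹' {0}).Countable := by
  have : f ⁻¹' {0} ⊆ ⋃ n : ℕ, closedRect (-n - n * I) (2 * n) (2 * n) ∩ f ⁻¹' {0} := by
    intro ζ hζ
    obtain ⟨n, hn⟩ := exists_nat_ge ‖ζ‖
    have h1 := abs_le.1 ((abs_re_le_norm ζ).trans hn)
    have h2 := abs_le.1 ((abs_im_le_norm ζ).trans hn)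
    refine mem_iUnion.2 ⟨n, ⟨⟨?_, ?_⟩, ?_, ?_⟩, hζ⟩ <;> simp <;> linarith
  exact (countable_iUnion fun n => (finite_zeros_closedRect hf h _ _ _).countable).mono this

theorem differentiable_deriv_sub_mul {f : ℂ → ℂ} (hf : Differentiable ℂ f) (μ : ℂ) :
    Differentiable ℂ fun ζ => deriv f ζ - μ * f ζ :=
  hf.deriv.sub (hf.const_mul μ)

theorem hasDerivAt_exp_neg_mul {f : ℂ → ℂ} (hf : Differentiable ℂ f) (μ ζ : ℂ) :
    HasDerivAt (fun ζ => exp (-μ * ζ) * f ζ) (exp (-μ * ζ) * (deriv f ζ - μ * f ζ)) ζ := by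
  have hE : HasDerivAt (fun ζ => exp (-μ * ζ)) (exp (-μ * ζ) * -μ) ζ := by
    simpa using ((hasDerivAt_id ζ).const_mul (-μ)).cexp
  exact (hE.mul (hf ζ).hasDerivAt).congr_deriv (by ring)

theorem eq_const_mul_exp_of_deriv_sub_mul_eq_zero {f : ℂ → ℂ} (hf : Differentiable ℂ f) {μ : ℂ}
    (h : (fun ζ => deriv f ζ - μ * f ζ) = 0) : ∃ c, ∀ ζ, exp (-μ * ζ) * f ζ = c := by
  refine ⟨exp (-μ * 0) * f 0, fun ζ => ?_⟩
  refine is_const_of_deriv_eq_zero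
    (fun ζ => (hasDerivAt_exp_neg_mul hf μ ζ).differentiableAt) (fun ζ => ?_) ζ 0
  rw [(hasDerivAt_exp_neg_mul hf μ ζ).deriv, congrFun h ζ]
  simp

theorem rectVariation_const (c z : ℂ) (w h : ℝ) : rectVariation (fun _ => c) z w h = 0 := by
  simp [rectVariation, edgeVariation, logDeriv_const]

theorem polygonalLength_nonneg (p : List ℂ) : 0 ≤ polygonalLength p := by
  induction p with
  | nil => simp [polygonalLength]
  | cons a p ih =>
    cases p with
    | nil => simp [polygonalLength]
    | cons b p => exact add_nonneg dist_nonneg ih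

/-- The induction rests on (e^{-μζ} f)' = e^{(ν-μ)ζ} · e^{-νζ}(f' - μf): Rolle costs 2π, the first
exponential costs |ν - μ| times the perimeter. The countable set collects the zeros of all functions
met on the way, which the lines of the rectangle must avoid. -/
theorem rectVariation_le_of_applyFactors_eq_zero (l : List ℂ) (μ : ℂ) {f : ℂ → ℂ}
    (hf : Differentiable ℂ f) (hne : f ≠ 0) (h : applyFactors (μ :: l) f = 0) :
    ∃ C : Set ℂ, C.Countable ∧ ∀ (z : ℂ) (w h : ℝ), 0 ≤ w → 0 ≤ h →
      (∀ ζ ∈ rectLines z w h, ζ ∉ C) → (∀ ζ ∈ rectLines z w h, f ζ ≠ 0) ∧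
      rectVariation (fun ζ => exp (-μ * ζ) * f ζ) z w h ≤
        2 * Real.pi * l.length + (2 * w + 2 * h) * polygonalLength (μ :: l) := by
  induction l generalizing μ f with
  | nil =>
    refine ⟨f ⁻¹' {0}, countable_zeros_of_entire hf hne, fun z w h' hw hh hC => ⟨hC, ?_⟩⟩
    obtain ⟨c, hc⟩ := eq_const_mul_exp_of_deriv_sub_mul_eq_zero hf h
    simp only [hc, rectVariation_const, polygonalLength]
    simp
  | cons ν l ih =>
    by_cases h1 : (fun ζ => deriv f ζ - μ * f ζ) = 0
    -- The first factor already kills f, so e^{-μζ} f is constant and its variation is zero.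
    · refine ⟨f ⁻¹' {0}, countable_zeros_of_entire hf hne, fun z w h' hw hh hC => ⟨hC, ?_⟩⟩
      obtain ⟨c, hc⟩ := eq_const_mul_exp_of_deriv_sub_mul_eq_zero hf h1
      have := polygonalLength_nonneg (μ :: ν :: l)
      simp only [hc, rectVariation_const]
      positivity
    · have hg := differentiable_deriv_sub_mul hf μ
      obtain ⟨C, hC, hb⟩ := ih ν hg h1 h
      refine ⟨f ⁻¹' {0} ∪ C, (countable_zeros_of_entire hf hne).union hC,
        fun z w h' hw hh hav => ?_⟩
      have hf0 : ∀ ζ ∈ rectLines z w h', f ζ ≠ 0 := fun ζ hζ h0 => hav ζ hζ (Or.inl h0)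
      refine ⟨hf0, ?_⟩
      obtain ⟨hg0, hb⟩ := hb z w h' hw hh fun ζ hζ h0 => hav ζ hζ (Or.inr h0)
      have hd : deriv (fun ζ => exp (-μ * ζ) * f ζ) =
          fun ζ => exp ((ν - μ) * ζ) * (exp (-ν * ζ) * (deriv f ζ - μ * f ζ)) := by
        funext ζ
        rw [(hasDerivAt_exp_neg_mul hf μ ζ).deriv, ← mul_assoc, ← Complex.exp_add]
        congr 2
        ring
      have v1 := rectVariation_le_deriv
        (fun ζ => (hasDerivAt_exp_neg_mul hf μ ζ).differentiableAt) hw hh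
        (fun ζ hζ => mul_ne_zero (exp_ne_zero _) (hf0 ζ hζ)) (fun ζ hζ => by
          rw [(hasDerivAt_exp_neg_mul hf μ ζ).deriv]
          exact mul_ne_zero (exp_ne_zero _) (hg0 ζ hζ))
      have v2 := rectVariation_exp_mul_le
        (fun ζ => (hasDerivAt_exp_neg_mul hg ν ζ).differentiableAt) hw hh
        (fun ζ hζ => mul_ne_zero (exp_ne_zero _) (hg0 ζ hζ)) (ν - μ)
      rw [hd] at v1
      have hdist : ‖ν - μ‖ = dist μ ν := by rw [dist_comm, dist_eq_norm]
      rw [hdist] at v2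
      simp only [List.length_cons, polygonalLength] at hb ⊢
      push_cast
      linarith

theorem Set.Countable.exists_pos_lt_notMem {C : Set ℝ} (hC : C.Countable) {ε : ℝ} (hε : 0 < ε) :
    ∃ s, 0 < s ∧ s < ε ∧ s ∉ C := by
  obtain ⟨s, hs, h1, h2⟩ := (hC.dense_compl ℝ).exists_between hε
  exact ⟨s, h1, h2, hs⟩

/-- A countable set has countable projections to both axes, so arbitrarily small enlargements move
all four lines off it. -/
theorem exists_rect_avoiding {C : Set ℂ} (hC : C.Countable) (b α D : ℝ) {ε : ℝ} (hε : 0 < ε) :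
    ∃ s t : ℝ, 0 < s ∧ s < ε ∧ 0 < t ∧ t < ε ∧
      ∀ ζ ∈ rectLines (⟨b - (D + s), -(α + t)⟩ : ℂ) (2 * (D + s)) (2 * (α + t)), ζ ∉ C := by
  obtain ⟨s, hs0, hs1, hs⟩ := ((hC.image fun ζ => b - D - ζ.re).union
    (hC.image fun ζ => ζ.re - b - D)).exists_pos_lt_notMem hε
  obtain ⟨t, ht0, ht1, ht⟩ := ((hC.image fun ζ => -ζ.im - α).union
    (hC.image fun ζ => ζ.im - α)).exists_pos_lt_notMem hε
  refine ⟨s, t, hs0, hs1, ht0, ht1, fun ζ hζ hmem => ?_⟩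
  rcases hζ with h | h | h | h
  · exact hs (Or.inl ⟨ζ, hmem, by simp only [h]; ring⟩)
  · exact hs (Or.inr ⟨ζ, hmem, by simp only [h]; ring⟩)
  · exact ht (Or.inl ⟨ζ, hmem, by simp only [h]; ring⟩)
  · exact ht (Or.inr ⟨ζ, hmem, by simp only [h]; ring⟩)

theorem analyticOrderNatAt_exp_mul {f : ℂ → ℂ} (hf : Differentiable ℂ f) (h : f ≠ 0) (c z : ℂ) :
    analyticOrderNatAt (fun ζ => exp (c * ζ) * f ζ) z = analyticOrderNatAt f z := by
  have h1 : AnalyticAt ℂ (fun ζ : ℂ => exp (c * ζ)) z := by fun_prop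
  have h2 : analyticOrderAt (fun ζ : ℂ => exp (c * ζ)) z = 0 :=
    h1.analyticOrderAt_eq_zero.2 (exp_ne_zero _)
  have := analyticOrderNatAt_mul h1 (hf.analyticAt z) (by rw [h2]; simp)
    (analyticOrderAt_ne_top_of_entire hf h z)
  have h3 : analyticOrderNatAt (fun ζ : ℂ => exp (c * ζ)) z = 0 := by
    unfold analyticOrderNatAt
    rw [h2]
    rfl
  rw [h3, zero_add] at this
  exact this

/-- A bound for the number of zeros in a rectangle of a function that is annihilated by a product
of operators `d/dz - μ`. -/
theorem sum_order_le_of_applyFactors_eq_zero (l : List ℂ) {f : ℂ → ℂ}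
    (hf : Differentiable ℂ f) (hne : f ≠ 0) (h : applyFactors l f = 0) {α D : ℝ}
    (hα : 0 ≤ α) (hD : 0 ≤ D) (b : ℝ) {S : Finset ℂ}
    (hS : ∀ ζ ∈ S, |ζ.im| ≤ α ∧ |ζ.re - b| ≤ D) :
    ((∑ a ∈ S, analyticOrderNatAt f a : ℕ) : ℝ) ≤
      (l.length : ℝ) - 1 + 2 / Real.pi * (α + D) * polygonalLength l := by
  cases l with
  | nil => exact absurd h hne
  | cons μ l =>
    obtain ⟨C, hC, hb⟩ := rectVariation_le_of_applyFactors_eq_zero l μ hf hne h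
    -- The enlarged rectangle has perimeter at most 4(D + ε) + 4(α + ε); afterwards ε tends to 0.
    have key : ∀ ε > 0, 2 * Real.pi * (∑ a ∈ S, analyticOrderNatAt f a : ℕ) ≤
        2 * Real.pi * l.length +
          (4 * (D + ε) + 4 * (α + ε)) * polygonalLength (μ :: l) := by
      intro ε hε
      obtain ⟨s, t, hs0, hs1, ht0, ht1, hav⟩ := exists_rect_avoiding hC b α D hε
      have hw : 0 ≤ 2 * (D + s) := by linarith
      have hh : 0 ≤ 2 * (α + t) := by linarith
      obtain ⟨h0, hV⟩ := hb _ _ _ hw hh hav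
      have hcount := two_pi_mul_sum_order_le_rectVariation hw hh
        (fun ζ => (hasDerivAt_exp_neg_mul hf μ ζ).differentiableAt)
        (fun ζ hζ => mul_ne_zero (exp_ne_zero _) (h0 ζ hζ)) (S := S) (by
          intro ζ hζ
          obtain ⟨h1, h2⟩ := hS ζ hζ
          rw [abs_le] at h1 h2
          refine ⟨⟨?_, ?_⟩, ?_, ?_⟩ <;> simp only <;> linarith)
      simp only [analyticOrderNatAt_exp_mul hf hne] at hcount
      have hnn := polygonalLength_nonneg (μ :: l)
      refine hcount.trans (hV.trans ?_)
      have : 2 * (2 * (D + s)) + 2 * (2 * (α + t)) ≤ 4 * (D + ε) + 4 * (α + ε) := by linarith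
      gcongr
    have key2 : 2 * Real.pi * (∑ a ∈ S, analyticOrderNatAt f a : ℕ) ≤
        2 * Real.pi * l.length + (4 * D + 4 * α) * polygonalLength (μ :: l) := by
      have hcont : Filter.Tendsto (fun ε : ℝ => 2 * Real.pi * l.length +
          (4 * (D + ε) + 4 * (α + ε)) * polygonalLength (μ :: l)) (nhdsWithin 0 (Ioi 0))
          (nhds (2 * Real.pi * l.length +
            (4 * (D + 0) + 4 * (α + 0)) * polygonalLength (μ :: l))) :=
        (Continuous.tendsto (by fun_prop) 0).mono_left nhdsWithin_le_nhds
      rw [add_zero, add_zero] at hcont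
      exact ge_of_tendsto hcont (by filter_upwards [self_mem_nhdsWithin] with ε hε using key ε hε)
    have hpi := Real.pi_pos
    rw [List.length_cons]
    push_cast
    have h3 : (l.length : ℝ) + 1 - 1 + 2 / Real.pi * (α + D) * polygonalLength (μ :: l) =
        (2 * Real.pi * l.length + (4 * D + 4 * α) * polygonalLength (μ :: l)) /
          (2 * Real.pi) := by
      field_simp
      ring
    rw [h3, le_div_iff₀ (by positivity)]
    push_cast at key2
    linarith

end Annihilator

/-! ### Shortest polygonal paths may take the given points as vertices. -/

section ShortestPath

theorem polygonalLength_cons_le (a b : ℂ) (l : List ℂ) :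
    polygonalLength (a :: l) ≤ dist a b + polygonalLength (b :: l) := by
  cases l with
  | nil => simp [polygonalLength]
  | cons c l =>
    simp only [polygonalLength]
    linarith [dist_triangle a b c]

theorem polygonalLength_le_cons (a : ℂ) (l : List ℂ) :
    polygonalLength l ≤ polygonalLength (a :: l) := by
  cases l with
  | nil => simp [polygonalLength]
  | cons c l => simp [polygonalLength]

/-- Omitting a vertex does not lengthen a path, by the triangle inequality. A common first vertex
`a` makes the induction close. -/
theorem polygonalLength_cons_le_of_sublist {l p : List ℂ} (h : l.Sublist p) (a : ℂ) :
    polygonalLength (a :: l) ≤ polygonalLength (a :: p) := by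
  induction h generalizing a with
  | slnil => rfl
  | cons b _ ih => exact (polygonalLength_cons_le a b _).trans (add_le_add_right (ih b) _)
  | cons_cons b _ ih => exact add_le_add_right (ih b) _

theorem polygonalLength_le_of_sublist {l p : List ℂ} (h : l.Sublist p) :
    polygonalLength l ≤ polygonalLength p := by
  cases h with
  | slnil => rfl
  | cons b h => exact (polygonalLength_le_cons b _).trans (polygonalLength_cons_le_of_sublist h b)
  | cons_cons b h => exact polygonalLength_cons_le_of_sublist h b

theorem segment_subset_union_of_mem {z w v : ℂ} (hv : v ∈ segment ℝ z w) :
    segment ℝ z w ⊆ segment ℝ z v ∪ segment ℝ v w := by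
  have key : ∀ {z w : ℂ} {s t : ℝ}, 0 ≤ s → s ≤ t →
      z + s • (w - z) ∈ segment ℝ z (z + t • (w - z)) := by
    intro z w s t hs hst
    rcases eq_or_lt_of_le (hs.trans hst) with ht | ht
    · have : s = 0 := le_antisymm (ht ▸ hst) hs
      simp [this, left_mem_segment]
    · rw [segment_eq_image']
      refine ⟨s / t, ⟨by positivity, (div_le_one ht).2 hst⟩, ?_⟩
      simp only [add_sub_cancel_left, smul_smul, div_mul_cancel₀ _ ht.ne']
  intro u hu
  rw [segment_eq_image'] at hu hv
  obtain ⟨s, ⟨hs0, hs1⟩, rfl⟩ := hu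
  obtain ⟨t, ⟨ht0, ht1⟩, rfl⟩ := hv
  rcases le_total s t with h | h
  · exact Or.inl (key hs0 h)
  · right
    have := key (z := w) (w := z) (sub_nonneg.2 hs1) (sub_le_sub_left h 1)
    rw [segment_symm]
    have e : ∀ r : ℝ, w + (1 - r) • (z - w) = z + r • (w - z) := fun r => by
      simp only [Complex.real_smul]; push_cast; ring
    rwa [e, e] at this

/-- Subdividing an edge at v leaves the length unchanged. The trace must not shrink and the old
vertices must survive, so that further points can be inserted one after another. -/
theorem exists_insert_mem_polygonalTrace {v : ℂ} (l : List ℂ) (a : ℂ)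
    (hv : v ∈ polygonalTrace (a :: l)) :
    ∃ l', v ∈ a :: l' ∧ (∀ x ∈ l, x ∈ l') ∧
      polygonalTrace (a :: l) ⊆ polygonalTrace (a :: l') ∧
      polygonalLength (a :: l') = polygonalLength (a :: l) := by
  induction l generalizing a with
  | nil => exact ⟨[], by simpa [polygonalTrace] using hv, by simp, subset_rfl, rfl⟩
  | cons b l ih =>
    rcases hv with hv | hv
    · refine ⟨v :: b :: l, by simp, fun x hx => List.mem_cons_of_mem _ hx, ?_, ?_⟩
      · simp only [polygonalTrace]
        rw [← Set.union_assoc]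
        exact Set.union_subset_union_left _ (segment_subset_union_of_mem hv)
      · simp only [polygonalLength]
        rw [← add_assoc, dist_add_dist_of_mem_segment hv]
    · obtain ⟨l', h1, h2, h3, h4⟩ := ih b hv
      refine ⟨b :: l', List.mem_cons_of_mem _ h1, ?_, ?_, ?_⟩
      · intro x hx
        rcases List.mem_cons.1 hx with rfl | hx
        · simp
        · exact List.mem_cons_of_mem _ (h2 x hx)
      · exact Set.union_subset_union_right _ h3
      · simp only [polygonalLength, h4]

theorem exists_path_through_vertices (Λ : Finset ℂ) (p : List ℂ)
    (h : (Λ : Set ℂ) ⊆ polygonalTrace p) :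
    ∃ q : List ℂ, (∀ v ∈ Λ, v ∈ q) ∧ polygonalTrace p ⊆ polygonalTrace q ∧
      polygonalLength q = polygonalLength p := by
  induction Λ using Finset.induction_on with
  | empty => exact ⟨p, by simp, subset_rfl, rfl⟩
  | insert v Λ _ ih =>
    rw [Finset.coe_insert, Set.insert_subset_iff] at h
    obtain ⟨q, h1, h2, h3⟩ := ih h.2
    have hv := h2 h.1
    cases q with
    | nil => exact absurd hv (by simp [polygonalTrace])
    | cons a l =>
      obtain ⟨l', g1, g2, g3, g4⟩ := exists_insert_mem_polygonalTrace l a hv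
      refine ⟨a :: l', ?_, h2.trans g3, g4.trans h3⟩
      intro x hx
      rcases Finset.mem_insert.1 hx with rfl | hx
      · exact g1
      · rcases List.mem_cons.1 (h1 x hx) with rfl | hx
        · simp
        · exact List.mem_cons_of_mem _ (g2 x hx)

/-- A polygonal path through finitely many points is at least as long as some polygonal path that
has exactly these points as its vertices. -/
theorem exists_list_polygonalLength_le {s : Multiset ℂ} (hs : s.Nodup) {p : List ℂ}
    (h : {μ | μ ∈ s} ⊆ polygonalTrace p) :
    ∃ l : List ℂ, (l : Multiset ℂ) = s ∧ polygonalLength l ≤ polygonalLength p := by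
  classical
  obtain ⟨q, h1, -, h3⟩ := exists_path_through_vertices s.toFinset p (fun x hx => h (by
    simpa using hx))
  -- Drop from q the vertices outside s and the repetitions; a sublist is no longer than q.
  refine ⟨(q.filter (· ∈ s)).dedup, ?_, ?_⟩
  · rw [Multiset.Nodup.ext (Multiset.coe_nodup.2 (List.nodup_dedup _)) hs]
    intro x
    simp only [Multiset.mem_coe, List.mem_dedup, List.mem_filter, decide_eq_true_eq]
    exact ⟨fun hx => hx.2, fun hx => ⟨h1 x (Multiset.mem_toFinset.2 hx), hx⟩⟩
  · rw [← h3]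
    exact polygonalLength_le_of_sublist ((List.dedup_sublist _).trans List.filter_sublist)

theorem shortestPathLength_nonneg (Λ : Set ℂ) : 0 ≤ shortestPathLength Λ :=
  Real.sInf_nonneg (by rintro _ ⟨p, -, rfl⟩; exact polygonalLength_nonneg p)

theorem mem_subset_polygonalTrace (l : List ℂ) : {μ | μ ∈ l} ⊆ polygonalTrace l := by
  induction l with
  | nil => simp [polygonalTrace]
  | cons a l ih =>
    cases l with
    | nil => simp [polygonalTrace]
    | cons b l =>
      rintro x hx
      rcases List.mem_cons.1 hx with rfl | hx
      · exact Or.inl (left_mem_segment ℝ _ _)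
      · exact Or.inr (ih hx)

/-- The length of the shortest path is attained by a path that has exactly the given points as its
vertices, up to an arbitrarily small error. -/
theorem exists_list_polygonalLength_lt {s : Multiset ℂ} (hs : s.Nodup) {ε : ℝ} (hε : 0 < ε) :
    ∃ l : List ℂ, (l : Multiset ℂ) = s ∧
      polygonalLength l < shortestPathLength {μ | μ ∈ s} + ε := by
  have hne : {ℓ | ∃ p : List ℂ, {μ | μ ∈ s} ⊆ polygonalTrace p ∧
      ℓ = polygonalLength p}.Nonempty := by
    refine ⟨_, s.toList, ?_, rfl⟩
    simpa using mem_subset_polygonalTrace s.toList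
  obtain ⟨_, ⟨p, hp, rfl⟩, hlt⟩ := exists_lt_of_csInf_lt hne (lt_add_of_pos_right _ hε)
  obtain ⟨l, h1, h2⟩ := exists_list_polygonalLength_le hs hp
  exact ⟨l, h1, h2.trans_lt hlt⟩

end ShortestPath

/-! ### Solutions as functions killed by linear factors, and as exponential polynomials. -/

section ODE

/-- The space of entire functions. -/
def entireFunctions : Submodule ℂ (ℂ → ℂ) where
  carrier := {f | Differentiable ℂ f}
  add_mem' hf hg := Differentiable.add hf hg
  zero_mem' := differentiable_const 0
  smul_mem' c _ hf := Differentiable.const_smul hf c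

/-- Differentiation as an endomorphism of the space of entire functions. -/
noncomputable def entireDeriv : Module.End ℂ entireFunctions where
  toFun f := ⟨deriv f.1, Differentiable.deriv f.2⟩
  map_add' f g := Subtype.ext (funext fun z => deriv_add (f.2 z) (g.2 z))
  map_smul' c f := Subtype.ext (funext fun z => deriv_const_smul c (f.2 z))

theorem entireDeriv_pow_apply (n : ℕ) (f : entireFunctions) :
    ((entireDeriv ^ n) f : ℂ → ℂ) = iteratedDeriv n f.1 := by
  induction n with
  | zero => simp
  | succ n ih =>
    rw [pow_succ', Module.End.mul_apply, iteratedDeriv_succ, ← ih]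
    rfl

theorem applyFactors_eq_aeval (l : List ℂ) (f : entireFunctions) :
    applyFactors l f.1 =
      (aeval entireDeriv ((l.map fun μ => X - C μ).prod) f : entireFunctions).1 := by
  induction l generalizing f with
  | nil => simp [applyFactors]
  | cons μ l ih =>
    rw [List.map_cons, List.prod_cons, mul_comm, map_mul, Module.End.mul_apply, ← ih]
    simp only [applyFactors]
    congr 1
    rw [map_sub, aeval_X, aeval_C]
    rfl

theorem odeCharPoly_coeff {k : ℕ} (a : Fin (k + 1) → ℂ) (j : Fin (k + 1)) :
    (odeCharPoly a).coeff j = a j := by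
  simp [odeCharPoly, coeff_X_pow, Fin.val_inj]

theorem natDegree_odeCharPoly {k : ℕ} {a : Fin (k + 1) → ℂ} (ha : a (Fin.last k) ≠ 0) :
    (odeCharPoly a).natDegree = k := by
  refine le_antisymm ?_ (le_natDegree_of_ne_zero ?_)
  · refine natDegree_sum_le_of_forall_le _ _ fun j _ => ?_
    exact (natDegree_C_mul_X_pow_le _ _).trans (Nat.lt_succ_iff.1 j.2)
  · have := odeCharPoly_coeff a (Fin.last k)
    rw [Fin.val_last] at this
    rwa [this]

theorem card_roots_odeCharPoly {k : ℕ} {a : Fin (k + 1) → ℂ} (ha : a (Fin.last k) ≠ 0) :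
    (odeCharPoly a).roots.card = k := by
  rw [← (IsAlgClosed.splits (odeCharPoly a)).natDegree_eq_card_roots, natDegree_odeCharPoly ha]

/-- Polynomials in the derivation commute, so the roots may be listed in any order. This freedom
later lets the order follow a nearly shortest path. -/
theorem applyFactors_eq_zero_of_isODESolution {k : ℕ} {a : Fin (k + 1) → ℂ}
    (ha : a (Fin.last k) ≠ 0) {y : ℂ → ℂ} (hy : IsODESolution a y) {l : List ℂ}
    (hl : (l : Multiset ℂ) = (odeCharPoly a).roots) : applyFactors l y = 0 := by
  have h1 : aeval entireDeriv (odeCharPoly a) (⟨y, hy.1⟩ : entireFunctions) = 0 := by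
    refine Subtype.ext (funext fun z => ?_)
    rw [odeCharPoly, map_sum, LinearMap.sum_apply, AddSubmonoidClass.coe_finsetSum,
      Finset.sum_apply]
    refine Eq.trans (Finset.sum_congr rfl fun j _ => ?_) (hy.2 z)
    rw [map_mul, map_pow, aeval_X, aeval_C, Module.End.mul_apply, Module.algebraMap_end_apply]
    have := congrFun (entireDeriv_pow_apply j ⟨y, hy.1⟩) z
    simp only [Submodule.coe_smul, Pi.smul_apply, smul_eq_mul, this]
  have h2 := (IsAlgClosed.splits (odeCharPoly a)).eq_prod_roots
  have h3 : (odeCharPoly a).leadingCoeff ≠ 0 := by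
    rw [leadingCoeff, natDegree_odeCharPoly ha]
    have := odeCharPoly_coeff a (Fin.last k)
    rw [Fin.val_last] at this
    rwa [this]
  rw [h2, ← hl, Multiset.map_coe, Multiset.prod_coe, map_mul, aeval_C, Module.End.mul_apply,
    Module.algebraMap_end_apply, smul_eq_zero] at h1
  rw [applyFactors_eq_aeval l ⟨y, hy.1⟩, h1.resolve_left h3]
  rfl

/-- Differentiation is nilpotent on polynomials of degree < n, so its sum with c ≠ 0 is invertible
there. The induction solves with P'/c and corrects P/c. -/
theorem exists_derivative_add_mul_eq {c : ℂ} (hc : c ≠ 0) (n : ℕ) (P : ℂ[X]) (hP : P.degree < n) :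
    ∃ Q : ℂ[X], Q.degree < n ∧ derivative Q + C c * Q = P := by
  induction n generalizing P with
  | zero =>
    have : P = 0 := by simpa [Polynomial.degree_eq_bot] using hP
    exact ⟨0, by simp, by simp [this]⟩
  | succ n ih =>
    have hd : (derivative P).degree < n := by
      by_cases h0 : P = 0
      · simp [h0]
      · have h1 := degree_derivative_lt h0
        rw [degree_eq_natDegree h0] at h1 hP
        have h2 : P.natDegree ≤ n := by
          have : P.natDegree < n + 1 := by exact_mod_cast hP
          omega
        exact h1.trans_le (by exact_mod_cast h2)
    obtain ⟨Q, hQ, hQ'⟩ := ih (C c⁻¹ * derivative P) (by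
      rw [degree_C_mul (inv_ne_zero hc)]; exact hd)
    refine ⟨C c⁻¹ * P - Q, ?_, ?_⟩
    · refine (degree_sub_le _ _).trans_lt (max_lt ?_ ?_)
      · rwa [degree_C_mul (inv_ne_zero hc)]
      · exact hQ.trans (by exact_mod_cast n.lt_succ_self)
    · have h1 : C c * (C c⁻¹ * P) = P := by
        rw [← mul_assoc, ← C_mul, mul_inv_cancel₀ hc, C_1, one_mul]
      rw [derivative_sub, derivative_C_mul, mul_sub, h1]
      linear_combination -hQ'

theorem exists_derivative_eq (n : ℕ) (P : ℂ[X]) (hP : P.degree < n) :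
    ∃ Q : ℂ[X], Q.degree < (n + 1 : ℕ) ∧ derivative Q = P := by
  by_cases h0 : P = 0
  · exact ⟨0, by simp, by simp [h0]⟩
  have hn : P.natDegree < n := by
    rw [degree_eq_natDegree h0] at hP
    exact_mod_cast hP
  refine ⟨∑ i ∈ Finset.range n, C (P.coeff i / (i + 1)) * X ^ (i + 1), ?_, ?_⟩
  · refine (degree_sum_le _ _).trans_lt ((Finset.sup_lt_iff (WithBot.bot_lt_coe _)).2 fun i hi => ?_)
    refine (degree_C_mul_X_pow_le _ _).trans_lt ?_
    have := Finset.mem_range.1 hi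
    exact_mod_cast (by omega : i + 1 < n + 1)
  · rw [derivative_sum]
    conv_rhs => rw [P.as_sum_range_C_mul_X_pow' (n := n) hn]
    refine Finset.sum_congr rfl fun i _ => ?_
    rw [derivative_C_mul_X_pow]
    congr 2
    have : (i : ℂ) + 1 ≠ 0 := by exact_mod_cast i.succ_ne_zero
    push_cast
    field_simp

/-- Functions annihilated by a product of operators `d/dz - μ` are exponential polynomials. -/
theorem exists_eq_sum_eval_mul_exp (T : Finset ℂ) (l : List ℂ) (hl : ∀ μ ∈ l, μ ∈ T) {f : ℂ → ℂ}
    (hf : Differentiable ℂ f) (h : applyFactors l f = 0) :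
    ∃ P : ℂ → ℂ[X], (∀ μ, (P μ).degree < (l.count μ : ℕ)) ∧
      ∀ z, f z = ∑ μ ∈ T, (P μ).eval z * Complex.exp (μ * z) := by
  induction l generalizing f with
  | nil => exact ⟨fun _ => 0, by simp, fun z => by simpa [applyFactors] using congrFun h z⟩
  | cons μ l ih =>
    obtain ⟨P, hP, hg⟩ := ih (fun ν hν => hl ν (List.mem_cons_of_mem _ hν))
      (differentiable_deriv_sub_mul hf μ) h
    have hQ : ∀ ν, ∃ Q : ℂ[X], Q.degree < ((μ :: l).count ν : ℕ) ∧
        derivative Q + C (ν - μ) * Q = P ν := by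
      -- In the resonant case ν = μ the degree bound grows by one, exactly as the multiplicity of μ
      -- in the list does; otherwise both stay the same.
      intro ν
      by_cases hν : ν = μ
      · subst hν
        obtain ⟨Q, h1, h2⟩ := exists_derivative_eq _ _ (hP ν)
        exact ⟨Q, by simpa using h1, by simpa using h2⟩
      · obtain ⟨Q, h1, h2⟩ := exists_derivative_add_mul_eq (sub_ne_zero.2 hν) _ _ (hP ν)
        exact ⟨Q, by rwa [List.count_cons_of_ne (Ne.symm hν)], h2⟩
    choose Q hQd hQ using hQ
    have hS : ∀ z, HasDerivAt (fun z => ∑ ν ∈ T, (Q ν).eval z * Complex.exp (ν * z))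
        (∑ ν ∈ T, ((derivative (Q ν)).eval z * Complex.exp (ν * z) +
          (Q ν).eval z * (Complex.exp (ν * z) * ν))) z := fun z => by
      refine HasDerivAt.fun_sum fun ν _ => ((Q ν).hasDerivAt z).mul ?_
      simpa using ((hasDerivAt_id z).const_mul ν).cexp
    -- The sum with coefficients Q is a particular solution; its difference from f is killed by d/dz
    -- - μ and is therefore c e^{μz}.
    have hd : Differentiable ℂ fun z => f z - ∑ ν ∈ T, (Q ν).eval z * Complex.exp (ν * z) :=
      hf.sub fun z => (hS z).differentiableAt
    obtain ⟨c, hc⟩ := eq_const_mul_exp_of_deriv_sub_mul_eq_zero hd (μ := μ) (by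
      funext z
      rw [((hf z).hasDerivAt.fun_sub (hS z)).deriv]
      have e : ∀ ν, (P ν).eval z = (derivative (Q ν)).eval z + (ν - μ) * (Q ν).eval z := by
        intro ν
        rw [← hQ ν]
        simp
      have := hg z
      simp only [e] at this
      rw [mul_sub, Finset.mul_sum, Pi.zero_apply]
      rw [sub_sub_sub_comm, this, ← Finset.sum_sub_distrib, ← Finset.sum_sub_distrib]
      exact Finset.sum_eq_zero fun ν _ => by ring)
    refine ⟨fun ν => Q ν + if ν = μ then C c else 0, fun ν => ?_, fun z => ?_⟩
    · refine (degree_add_le _ _).trans_lt (max_lt (hQd ν) ?_)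
      split_ifs with hν
      · subst hν
        refine degree_C_le.trans_lt ?_
        rw [List.count_cons_self]
        exact_mod_cast Nat.succ_pos _
      · simp
    · have h1 := hc z
      have h2 : f z = (∑ ν ∈ T, (Q ν).eval z * Complex.exp (ν * z)) + c * Complex.exp (μ * z) := by
        rw [← h1]
        have : Complex.exp (-μ * z) * Complex.exp (μ * z) = 1 := by
          rw [← Complex.exp_add]; simp
        linear_combination (-(f z - ∑ ν ∈ T, (Q ν).eval z * Complex.exp (ν * z))) * this
      have h3 : ∀ ν, eval z (Q ν + if ν = μ then C c else 0) * Complex.exp (ν * z) =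
          (Q ν).eval z * Complex.exp (ν * z) + if ν = μ then c * Complex.exp (ν * z) else 0 := by
        intro ν
        split_ifs <;> simp [add_mul]
      rw [h2]
      simp only [h3, Finset.sum_add_distrib]
      rw [Finset.sum_ite_eq', if_pos (hl μ (by simp))]

end ODE

/-! ### From zeros in rectangles to zeros in a covered strip. -/

section Covering

theorem zeroCount_le_of_forall_sum_le {f : ℂ → ℂ} (hf : Differentiable ℂ f) (hne : f ≠ 0)
    {U : Set ℂ} {N : ℕ}
    (h : ∀ S : Finset ℂ, (S : Set ℂ) ⊆ U → ∑ a ∈ S, analyticOrderNatAt f a ≤ N) :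
    zeroCount f U ≤ N := by
  refine iSup₂_le fun S hS => ?_
  have h1 := h S hS
  have h2 : ∑ z ∈ S, analyticOrderAt f z = (∑ a ∈ S, analyticOrderNatAt f a : ℕ) := by
    rw [Nat.cast_sum]
    exact Finset.sum_congr rfl fun z _ =>
      (Nat.cast_analyticOrderNatAt (analyticOrderAt_ne_top_of_entire hf hne z)).symm
  rw [h2]
  exact_mod_cast h1

theorem sum_order_le_of_cover {ι : Type*} [Fintype ι] {l : List ℂ} {f : ℂ → ℂ}
    (hf : Differentiable ℂ f) (hne : f ≠ 0) (h : applyFactors l f = 0) {α D : ℝ} (hα : 0 ≤ α)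
    (hD : 0 ≤ D) {b : ι → ℝ}
    (hb : ∀ ζ ∈ horizontalStrip α, f ζ = 0 → ∃ i, |ζ.re - b i| ≤ D) {S : Finset ℂ}
    (hS : (S : Set ℂ) ⊆ horizontalStrip α) :
    ((∑ a ∈ S, analyticOrderNatAt f a : ℕ) : ℝ) ≤ Fintype.card ι *
      ((l.length : ℝ) - 1 + 2 / Real.pi * (α + D) * polygonalLength l) := by
  classical
  have h1 : ∑ a ∈ S, analyticOrderNatAt f a ≤
      ∑ i : ι, ∑ a ∈ S with |a.re - b i| ≤ D, analyticOrderNatAt f a := by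
    simp only [Finset.sum_filter]
    rw [Finset.sum_comm]
    refine Finset.sum_le_sum fun a ha => ?_
    by_cases h0 : analyticOrderNatAt f a = 0
    · simp [h0]
    · obtain ⟨i, hi⟩ := hb a (hS ha) (apply_eq_zero_of_analyticOrderNatAt_ne_zero h0)
      refine le_trans ?_ (Finset.single_le_sum (fun _ _ => Nat.zero_le _) (Finset.mem_univ i))
      rw [if_pos hi]
  refine (Nat.cast_le.2 h1).trans ?_
  rw [Nat.cast_sum, ← nsmul_eq_mul]
  refine Finset.sum_le_card_nsmul _ _ _ fun i _ => ?_
  refine sum_order_le_of_applyFactors_eq_zero l hf hne h hα hD (b i) fun ζ hζ => ?_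
  obtain ⟨h2, h3⟩ := Finset.mem_filter.1 hζ
  exact ⟨hS h2, h3⟩

end Covering

/-! ### Localising the zeros when all roots are simple. -/

section SimpleRoots

theorem sum_range_pow_dist_le_of_le {k j : ℕ} (h : k ≤ j) :
    ∑ l ∈ Finset.range k, (1 / 4 : ℝ) ^ (l - j + (j - l)) ≤ 1 / 3 * (1 / 4) ^ (j - k) := by
  induction k with
  | zero => simp
  | succ k ih =>
    rw [Finset.sum_range_succ, show k - j + (j - k) = j - (k + 1) + 1 by omega]
    have := ih (by omega)
    rw [show j - k = j - (k + 1) + 1 by omega, pow_succ] at this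
    rw [pow_succ]
    linarith

theorem sum_range_pow_dist_le_of_lt (j n : ℕ) :
    ∑ l ∈ Finset.range (j + 1 + n), (1 / 4 : ℝ) ^ (l - j + (j - l)) ≤
      5 / 3 - 1 / 3 * (1 / 4) ^ n := by
  induction n with
  | zero =>
    have := sum_range_pow_dist_le_of_le (le_refl j)
    rw [add_zero, Finset.sum_range_succ]
    norm_num at this ⊢
    linarith
  | succ n ih =>
    rw [← add_assoc, Finset.sum_range_succ, show j + 1 + n - j + (j - (j + 1 + n)) = n + 1 by omega,
      pow_succ]
    linarith

/-- The exponent is |l - j| written with truncated subtraction. Each side of j contributes less than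
1/3; the ratio 1/4 is the origin of log 4 in the bound. -/
theorem sum_erase_pow_dist_lt_one {k : ℕ} (j : Fin k) :
    ∑ l ∈ Finset.univ.erase j, (1 / 4 : ℝ) ^ ((l : ℕ) - j + (j - l)) < 1 := by
  have h1 := sum_range_pow_dist_le_of_lt j (k - (j + 1))
  rw [show (j : ℕ) + 1 + (k - (j + 1)) = k by omega,
    Finset.sum_range fun l => (1 / 4 : ℝ) ^ (l - j + (j - l))] at h1
  rw [← Finset.add_sum_erase _ _ (Finset.mem_univ j)] at h1
  simp only [Nat.sub_self, add_zero, pow_zero] at h1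
  have : (0 : ℝ) < (1 / 4) ^ (k - (j + 1)) := by positivity
  linarith

variable {k : ℕ} {lam : Fin k → ℂ}

theorem rootTheta_nonneg (lam : Fin k → ℂ) : 0 ≤ rootTheta lam :=
  Real.iSup_nonneg fun _ => inv_nonneg.2 (abs_nonneg _)

theorem rootXi_nonneg (lam : Fin k → ℂ) : 0 ≤ rootXi lam :=
  Real.iSup_nonneg fun _ => abs_nonneg _

/-- For consecutive indices these are the definitions of Θ and Ξ as maxima; since the real parts
increase, the real gaps add up without cancellation. -/
theorem index_and_im_sub_le_add (hlam : StrictMono fun j => (lam j).re) (n j : ℕ)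
    (h : j + n < k) :
    (n : ℝ) ≤ rootTheta lam * ((lam ⟨j + n, h⟩).re - (lam ⟨j, by omega⟩).re) ∧
      |(lam ⟨j + n, h⟩).im - (lam ⟨j, by omega⟩).im| ≤
        rootXi lam * ((lam ⟨j + n, h⟩).re - (lam ⟨j, by omega⟩).re) := by
  induction n with
  | zero => simp
  | succ n ih =>
    obtain ⟨ih1, ih2⟩ := ih (by omega)
    have hT := le_ciSup (Set.finite_range fun i : Fin (k - 1) =>
      |(lam ⟨i, by omega⟩).re - (lam ⟨i + 1, by omega⟩).re|⁻¹).bddAbove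
        (⟨j + n, by omega⟩ : Fin (k - 1))
    have hX := le_ciSup (Set.finite_range fun i : Fin (k - 1) =>
      |((lam ⟨i, by omega⟩).im - (lam ⟨i + 1, by omega⟩).im) /
      ((lam ⟨i, by omega⟩).re - (lam ⟨i + 1, by omega⟩).re)|).bddAbove
        (⟨j + n, by omega⟩ : Fin (k - 1))
    change |(lam ⟨j + n, _⟩).re - (lam ⟨j + n + 1, _⟩).re|⁻¹ ≤ rootTheta lam at hT
    change |((lam ⟨j + n, _⟩).im - (lam ⟨j + n + 1, _⟩).im) /
      ((lam ⟨j + n, _⟩).re - (lam ⟨j + n + 1, _⟩).re)| ≤ rootXi lam at hX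
    have hpos : (lam ⟨j + n, by omega⟩).re < (lam ⟨j + n + 1, h⟩).re :=
      hlam (by simp [Fin.lt_def])
    have e : |(lam ⟨j + n, by omega⟩).re - (lam ⟨j + n + 1, h⟩).re| =
        (lam ⟨j + n + 1, h⟩).re - (lam ⟨j + n, by omega⟩).re := by
      rw [abs_of_neg (by linarith)]; ring
    have hp : 0 < (lam ⟨j + n + 1, h⟩).re - (lam ⟨j + n, by omega⟩).re := by linarith
    rw [e, inv_le_iff_one_le_mul₀ hp] at hT
    rw [abs_div, e, div_le_iff₀ hp] at hX
    change _ ≤ rootTheta lam * ((lam ⟨j + n + 1, h⟩).re - _) ∧ |(lam ⟨j + n + 1, h⟩).im - _| ≤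
      rootXi lam * ((lam ⟨j + n + 1, h⟩).re - _)
    constructor
    · push_cast
      linarith
    · have := abs_sub_le (lam ⟨j + n + 1, h⟩).im (lam ⟨j + n, by omega⟩).im
        (lam ⟨j, by omega⟩).im
      rw [abs_sub_comm (lam ⟨j + n, _⟩).im (lam ⟨j + n + 1, h⟩).im] at hX
      linarith

theorem index_and_im_sub_le (hlam : StrictMono fun j => (lam j).re) {i j : Fin k} (hij : i ≤ j) :
    (((j : ℕ) - i : ℕ) : ℝ) ≤ rootTheta lam * ((lam j).re - (lam i).re) ∧
      |(lam j).im - (lam i).im| ≤ rootXi lam * ((lam j).re - (lam i).re) := by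
  have hij' : (i : ℕ) ≤ j := hij
  have hji : (i : ℕ) + (j - i) = j := by omega
  have := index_and_im_sub_le_add hlam (j - i) i (by omega)
  simpa only [hji] using this

theorem norm_mul_exp_eq {c : ℂ} (hc : c ≠ 0) (μ ζ : ℂ) :
    ‖c * Complex.exp (μ * ζ)‖ = Real.exp (Real.log ‖c‖ + μ.re * ζ.re - μ.im * ζ.im) := by
  rw [norm_mul, Complex.norm_exp, Complex.mul_re, add_sub_assoc, Real.exp_add,
    Real.exp_log (norm_pos_iff.2 hc)]

/-- At every abscissa there is a dominant exponential; among several ones the fastest growing one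
is chosen. -/
theorem exists_dominant_index (c : Fin k → ℂ) (hc : ∃ j, c j ≠ 0) (ρ : Fin k → ℝ) (x : ℝ) :
    ∃ j, c j ≠ 0 ∧ (∀ l, c l ≠ 0 → Real.log ‖c l‖ + ρ l * x ≤ Real.log ‖c j‖ + ρ j * x) ∧
      ∀ l, c l ≠ 0 → j < l → Real.log ‖c l‖ + ρ l * x < Real.log ‖c j‖ + ρ j * x := by
  classical
  obtain ⟨j₀, hj₀⟩ := hc
  obtain ⟨j₁, h1, h2⟩ := Finset.exists_max_image (Finset.univ.filter fun j => c j ≠ 0)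
    (fun j => Real.log ‖c j‖ + ρ j * x) ⟨j₀, by simpa using hj₀⟩
  obtain ⟨j, h3, h4⟩ := Finset.exists_max_image (Finset.univ.filter fun j => c j ≠ 0 ∧
    Real.log ‖c j₁‖ + ρ j₁ * x ≤ Real.log ‖c j‖ + ρ j * x) id ⟨j₁, by simpa using h1⟩
  simp only [Finset.mem_filter, Finset.mem_univ, true_and, id] at h1 h2 h3 h4
  refine ⟨j, h3.1, fun l hl => (h2 l hl).trans h3.2, fun l hl hjl => ?_⟩
  by_contra hcon
  exact (h4 l ⟨hl, h3.2.trans (not_lt.1 hcon)⟩).not_gt hjl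

/-- The lines x ↦ log|c_j| + x Re λ_j have slopes increasing in j, so the index of the dominant line
is monotone in x. If it is constant on an interval of radius D about Re ζ, that single term
outweighs the sum of all others at ζ, which excludes a zero. -/
theorem exists_cover_zeros_of_simple (hlam : StrictMono fun j => (lam j).re) {c : Fin k → ℂ}
    (hc : ∃ j, c j ≠ 0) (α : ℝ) :
    ∃ b : Fin (k - 1) → ℝ, ∀ ζ ∈ horizontalStrip α,
      ∑ j, c j * Complex.exp (lam j * ζ) = 0 →
        ∃ i, |ζ.re - b i| ≤ α * rootXi lam + rootTheta lam * Real.log 4 := by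
  set D := α * rootXi lam + rootTheta lam * Real.log 4 with hD
  choose J hJ0 hJ1 hJ2 using exists_dominant_index c hc fun j => (lam j).re
  have hmono : Monotone J := by
    intro x x' hx
    by_contra hlt
    rw [not_le] at hlt
    have h1 := hJ1 x (J x') (hJ0 x')
    have h2 := hJ2 x' (J x) (hJ0 x) hlt
    have h3 : (lam (J x')).re < (lam (J x)).re := hlam hlt
    nlinarith
  -- This is the abscissa where the dominant index passes i. For an unused i the set may be empty or
  -- unbounded below and the value is irrelevant; below, only an i with a change inside the interval
  -- is chosen.
  refine ⟨fun i => sInf {x | (i : ℕ) + 1 ≤ J x}, fun ζ hζ h0 => ?_⟩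
  by_cases hJ : J (ζ.re - D) < J (ζ.re + D)
  · have hJ' : (J (ζ.re - D) : ℕ) < J (ζ.re + D) := hJ
    refine ⟨⟨J (ζ.re - D), by omega⟩, ?_⟩
    have hmem : ζ.re + D ∈ {x | (J (ζ.re - D) : ℕ) + 1 ≤ J x} := hJ'
    have hlb : ∀ x ∈ {x | (J (ζ.re - D) : ℕ) + 1 ≤ J x}, ζ.re - D ≤ x := by
      intro x hx
      by_contra hlt
      have h1 : (J x : ℕ) ≤ J (ζ.re - D) := hmono (not_le.1 hlt).le
      have h2 : (J (ζ.re - D) : ℕ) + 1 ≤ J x := hx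
      omega
    have h1 := csInf_le ⟨_, hlb⟩ hmem
    have h2 := le_csInf ⟨_, hmem⟩ hlb
    rw [abs_le]
    constructor <;> linarith
  · exfalso
    have hζ' : |ζ.im| ≤ α := hζ
    have hα : 0 ≤ α := (abs_nonneg _).trans hζ'
    have hD0 : 0 ≤ D := add_nonneg (mul_nonneg hα (rootXi_nonneg lam))
      (mul_nonneg (rootTheta_nonneg lam) (Real.log_nonneg (by norm_num)))
    have hJe : J (ζ.re + D) = J (ζ.re - D) :=
      le_antisymm (not_lt.1 hJ) (hmono (by linarith))
    set j := J (ζ.re - D) with hj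
    have hcj : c j ≠ 0 := hJ0 _
    have hup := hJ1 (ζ.re + D)
    rw [hJe] at hup
    have hdown := hJ1 (ζ.re - D)
    rw [← hj] at hdown
    -- Moving by D along the real axis gains D times the gap of real parts. This pays for a factor 4
    -- per index step and for the effect of Im ζ. Terms above j are compared at Re ζ + D, terms
    -- below j at Re ζ - D.
    have hpair : ∀ {i l : Fin k}, i ≤ l →
        (((l : ℕ) - i : ℕ) : ℝ) * Real.log 4 + |((lam l).im - (lam i).im) * ζ.im| ≤
          D * ((lam l).re - (lam i).re) := by
      intro i l hil
      obtain ⟨h1, h2⟩ := index_and_im_sub_le hlam hil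
      have h3 : (((l : ℕ) - i : ℕ) : ℝ) * Real.log 4 ≤
          rootTheta lam * ((lam l).re - (lam i).re) * Real.log 4 :=
        mul_le_mul_of_nonneg_right h1 (Real.log_nonneg (by norm_num))
      have h4 : |((lam l).im - (lam i).im) * ζ.im| ≤
          rootXi lam * ((lam l).re - (lam i).re) * α := by
        rw [abs_mul]
        exact mul_le_mul h2 hζ' (abs_nonneg _) ((abs_nonneg _).trans h2)
      rw [hD]
      linarith
    have hterm : ∀ l, ‖c l * Complex.exp (lam l * ζ)‖ ≤
        ‖c j * Complex.exp (lam j * ζ)‖ * (1 / 4) ^ ((l : ℕ) - j + (j - l)) := by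
      intro l
      by_cases hcl : c l = 0
      · rw [hcl, zero_mul, norm_zero]
        positivity
      rw [norm_mul_exp_eq hcl, norm_mul_exp_eq hcj]
      have h4 : ∀ n : ℕ, (1 / 4 : ℝ) ^ n = Real.exp (-(n * Real.log 4)) := by
        intro n
        rw [← mul_neg, ← Real.log_inv, Real.exp_nat_mul, Real.exp_log (by norm_num), one_div]
      rw [h4, ← Real.exp_add, Real.exp_le_exp]
      rcases le_total l j with hlj | hjl
      · have h5 := hpair hlj
        have h6 := hdown l hcl
        have h7 := le_abs_self (((lam j).im - (lam l).im) * ζ.im)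
        have h8 : (l : ℕ) ≤ j := hlj
        rw [show (l : ℕ) - j + (j - l) = j - l by omega]
        nlinarith
      · have h5 := hpair hjl
        have h6 := hup l hcl
        have h7 := neg_le_abs (((lam l).im - (lam j).im) * ζ.im)
        have h8 : (j : ℕ) ≤ l := hjl
        rw [show (l : ℕ) - j + (j - l) = l - j by omega]
        nlinarith
    have hsum := Finset.add_sum_erase Finset.univ
      (fun l => c l * Complex.exp (lam l * ζ)) (Finset.mem_univ j)
    rw [h0, add_eq_zero_iff_eq_neg] at hsum
    have hpos : 0 < ‖c j * Complex.exp (lam j * ζ)‖ :=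
      norm_pos_iff.2 (mul_ne_zero hcj (Complex.exp_ne_zero _))
    have h9 : ‖c j * Complex.exp (lam j * ζ)‖ ≤ ‖c j * Complex.exp (lam j * ζ)‖ *
        ∑ l ∈ Finset.univ.erase j, (1 / 4 : ℝ) ^ ((l : ℕ) - j + (j - l)) := by
      conv_lhs => rw [hsum, norm_neg]
      refine (norm_sum_le _ _).trans ?_
      rw [Finset.mul_sum]
      exact Finset.sum_le_sum fun l _ => hterm l
    have h10 := sum_erase_pow_dist_lt_one j
    nlinarith

end SimpleRoots

/-! ### Localising the zeros of general exponential polynomials. -/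

section MultipleRoots

/-- Factor p over its roots: |z' - w| ≤ |z - w|(1 + |z' - z|/δ) for each root w, and 1 + x ≤ e^x. -/
theorem norm_eval_le_mul_exp {p : ℂ[X]} {k : ℕ} (hp : p.natDegree ≤ k) {δ : ℝ} (hδ : 0 < δ)
    {z : ℂ} (hz : ∀ w ∈ p.roots, δ ≤ ‖z - w‖) (z' : ℂ) :
    ‖p.eval z'‖ ≤ ‖p.eval z‖ * Real.exp (k * (‖z' - z‖ / δ)) := by
  have heval : ∀ x, ‖p.eval x‖ = ‖p.leadingCoeff‖ * (p.roots.map fun w => ‖x - w‖).prod := by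
    intro x
    conv_lhs => rw [(IsAlgClosed.splits p).eq_prod_roots]
    rw [eval_mul, eval_C, eval_multiset_prod, norm_mul, Multiset.map_map]
    congr 1
    have := map_multiset_prod (normHom : ℂ →*₀ ℝ) (p.roots.map fun w => x - w)
    simpa [Multiset.map_map, Function.comp_def] using this
  have hr : 0 ≤ ‖z' - z‖ / δ := by positivity
  have hprod : ∀ s : Multiset ℂ, (∀ w ∈ s, δ ≤ ‖z - w‖) →
      (s.map fun w => ‖z' - w‖).prod ≤
        (s.map fun w => ‖z - w‖).prod * Real.exp (s.card * (‖z' - z‖ / δ)) := by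
    intro s
    induction s using Multiset.induction_on with
    | empty => simp
    | cons w s ih =>
      intro hs
      have h1 := ih fun v hv => hs v (Multiset.mem_cons_of_mem hv)
      have h2 := hs w (Multiset.mem_cons_self w s)
      have h3 : ‖z' - w‖ ≤ ‖z - w‖ * Real.exp (‖z' - z‖ / δ) := by
        have h4 : ‖z' - w‖ ≤ ‖z' - z‖ + ‖z - w‖ := norm_sub_le_norm_sub_add_norm_sub _ _ _
        have h5 := Real.add_one_le_exp (‖z' - z‖ / δ)
        have h6 : ‖z' - z‖ ≤ ‖z - w‖ * (‖z' - z‖ / δ) := by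
          rw [mul_div_assoc', le_div_iff₀ hδ]
          nlinarith [norm_nonneg (z' - z)]
        nlinarith [norm_nonneg (z - w)]
      simp only [Multiset.map_cons, Multiset.prod_cons, Multiset.card_cons]
      push_cast
      rw [add_mul, one_mul, Real.exp_add]
      calc _ ≤ ‖z - w‖ * Real.exp (‖z' - z‖ / δ) * ((s.map fun w => ‖z - w‖).prod *
            Real.exp (s.card * (‖z' - z‖ / δ))) := by
            refine mul_le_mul h3 h1 (Multiset.prod_nonneg ?_) (by positivity)
            intro a ha
            obtain ⟨v, -, rfl⟩ := Multiset.mem_map.1 ha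
            exact norm_nonneg _
        _ = _ := by ring
  have hnn : 0 ≤ (p.roots.map fun w => ‖z - w‖).prod := by
    refine Multiset.prod_nonneg fun a ha => ?_
    obtain ⟨v, -, rfl⟩ := Multiset.mem_map.1 ha
    exact norm_nonneg _
  rw [heval, heval, mul_assoc]
  refine mul_le_mul_of_nonneg_left ((hprod _ hz).trans ?_) (norm_nonneg _)
  have hcard : (p.roots.card : ℝ) ≤ k := by exact_mod_cast (card_roots' p).trans hp
  gcongr

/-- Abscissas of two points where the same two terms are comparable are close to each other. -/
theorem abs_re_sub_le_of_comparable {p q : ℂ[X]} {k : ℕ} (hp : p.natDegree ≤ k)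
    (hq : q.natDegree ≤ k) {μ ν ζ ζ' : ℂ} {α g M K : ℝ} (hg : 0 < g)
    (hg' : g ≤ |μ.re - ν.re|) (hM : |μ.im - ν.im| ≤ M) (hK : 1 ≤ K)
    (hζ : |ζ.im| ≤ α) (hζ' : |ζ'.im| ≤ α)
    (hpr : ∀ w ∈ p.roots, 4 * (k + 1) / g ≤ ‖ζ - w‖)
    (hqr : ∀ w ∈ q.roots, 4 * (k + 1) / g ≤ ‖ζ - w‖)
    (hpr' : ∀ w ∈ p.roots, 4 * (k + 1) / g ≤ ‖ζ' - w‖)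
    (hqr' : ∀ w ∈ q.roots, 4 * (k + 1) / g ≤ ‖ζ' - w‖)
    (hp0 : p.eval ζ ≠ 0) (hq0 : q.eval ζ ≠ 0) (hp0' : p.eval ζ' ≠ 0) (hq0' : q.eval ζ' ≠ 0)
    (h1 : ‖p.eval ζ * Complex.exp (μ * ζ)‖ ≤ K * ‖q.eval ζ * Complex.exp (ν * ζ)‖)
    (h2 : ‖q.eval ζ * Complex.exp (ν * ζ)‖ ≤ K * ‖p.eval ζ * Complex.exp (μ * ζ)‖)
    (h1' : ‖p.eval ζ' * Complex.exp (μ * ζ')‖ ≤ K * ‖q.eval ζ' * Complex.exp (ν * ζ')‖)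
    (h2' : ‖q.eval ζ' * Complex.exp (ν * ζ')‖ ≤ K * ‖p.eval ζ' * Complex.exp (μ * ζ')‖) :
    |ζ'.re - ζ.re| ≤ 2 / g * (2 * α * M + 2 * Real.log K + g * α) := by
  set δ := 4 * (k + 1) / g with hδ
  have hδ0 : 0 < δ := by positivity
  have hK0 : 0 < K := by linarith
  have hlog : ∀ {r : ℂ[X]} {x x' : ℂ}, r.natDegree ≤ k → (∀ w ∈ r.roots, δ ≤ ‖x - w‖) →
      r.eval x ≠ 0 → r.eval x' ≠ 0 →
      Real.log ‖r.eval x'‖ ≤ Real.log ‖r.eval x‖ + k * (‖x' - x‖ / δ) := by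
    intro r x x' hr hroots hx hx'
    have h := Real.log_le_log (norm_pos_iff.2 hx') (norm_eval_le_mul_exp hr hδ0 hroots x')
    rwa [Real.log_mul (norm_ne_zero_iff.2 hx) (Real.exp_ne_zero _), Real.log_exp] at h
  have hcomp : ∀ {a b σ τ x : ℂ}, a ≠ 0 → b ≠ 0 →
      ‖a * Complex.exp (σ * x)‖ ≤ K * ‖b * Complex.exp (τ * x)‖ →
      Real.log ‖a‖ + σ.re * x.re - σ.im * x.im ≤
        Real.log K + (Real.log ‖b‖ + τ.re * x.re - τ.im * x.im) := by
    intro a b σ τ x ha hb h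
    rw [norm_mul_exp_eq ha, norm_mul_exp_eq hb] at h
    have h := Real.log_le_log (Real.exp_pos _) h
    rwa [Real.log_exp, Real.log_mul hK0.ne' (Real.exp_ne_zero _), Real.log_exp] at h
  have a1 := hcomp hp0 hq0 h1
  have a2 := hcomp hq0 hp0 h2
  have a1' := hcomp hp0' hq0' h1'
  have a2' := hcomp hq0' hp0' h2'
  have b1 := hlog hp hpr hp0 hp0'
  have b2 := hlog hp hpr' hp0' hp0
  have b3 := hlog hq hqr hq0 hq0'
  have b4 := hlog hq hqr' hq0' hq0
  rw [norm_sub_rev ζ ζ'] at b2 b4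
  have hα : 0 ≤ α := (abs_nonneg _).trans hζ
  have him : |ζ'.im - ζ.im| ≤ 2 * α := by
    have := abs_sub ζ'.im ζ.im
    linarith
  have hnorm : ‖ζ' - ζ‖ ≤ |ζ'.re - ζ.re| + 2 * α := by
    have := Complex.norm_le_abs_re_add_abs_im (ζ' - ζ)
    rw [Complex.sub_re, Complex.sub_im] at this
    linarith
  -- The choice δ = 4(k + 1)/g makes the variation of the polynomial factors use up at most half of
  -- the growth g|Re ζ' - Re ζ| of the exponentials, so it can be absorbed.
  have he : 2 * (k * (‖ζ' - ζ‖ / δ)) ≤ g / 2 * (|ζ'.re - ζ.re| + 2 * α) := by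
    have : 2 * ((k : ℝ) * (‖ζ' - ζ‖ / δ)) = g / 2 * ((k / (k + 1)) * ‖ζ' - ζ‖) := by
      rw [hδ]
      field_simp
      ring
    rw [this]
    have h3 : (k : ℝ) / (k + 1) ≤ 1 := by
      rw [div_le_one (by positivity)]
      linarith
    have h4 : (k : ℝ) / (k + 1) * ‖ζ' - ζ‖ ≤ ‖ζ' - ζ‖ := mul_le_of_le_one_left (norm_nonneg _) h3
    gcongr
    exact h4.trans hnorm
  have hmain : |(μ.re - ν.re) * (ζ'.re - ζ.re)| ≤ 2 * Real.log K +
      2 * (k * (‖ζ' - ζ‖ / δ)) + |(μ.im - ν.im) * (ζ'.im - ζ.im)| := by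
    have c1 := le_abs_self ((μ.im - ν.im) * (ζ'.im - ζ.im))
    have c2 := neg_le_abs ((μ.im - ν.im) * (ζ'.im - ζ.im))
    rw [abs_le]
    constructor <;> linarith
  have him2 : |(μ.im - ν.im) * (ζ'.im - ζ.im)| ≤ M * (2 * α) := by
    rw [abs_mul]
    exact mul_le_mul hM him (abs_nonneg _) ((abs_nonneg _).trans hM)
  have hre : g * |ζ'.re - ζ.re| ≤ |(μ.re - ν.re) * (ζ'.re - ζ.re)| := by
    rw [abs_mul]
    exact mul_le_mul_of_nonneg_right hg' (abs_nonneg _)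
  rw [div_mul_eq_mul_div, le_div_iff₀ hg]
  linarith

/-- In a vanishing sum some two terms are comparable. -/
theorem exists_comparable_of_sum_eq_zero {ι : Type*} (T : Finset ι) (t : ι → ℂ)
    (h0 : ∃ i ∈ T, t i ≠ 0) (hsum : ∑ i ∈ T, t i = 0) :
    ∃ i ∈ T, ∃ j ∈ T, i ≠ j ∧ t i ≠ 0 ∧ t j ≠ 0 ∧ ‖t i‖ ≤ T.card * ‖t j‖ ∧
      ‖t j‖ ≤ T.card * ‖t i‖ := by
  classical
  obtain ⟨i₀, hi₀, hne⟩ := h0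
  obtain ⟨i, hi, hmax⟩ := Finset.exists_max_image T (fun i => ‖t i‖) ⟨i₀, hi₀⟩
  have hpos : 0 < ‖t i‖ := (norm_pos_iff.2 hne).trans_le (hmax i₀ hi₀)
  have hcard : (1 : ℝ) ≤ T.card := by exact_mod_cast Finset.card_pos.2 ⟨i, hi⟩
  by_contra hcon
  push Not at hcon
  have hsmall : ∀ j ∈ T.erase i, T.card * ‖t j‖ < ‖t i‖ := by
    intro j hj
    obtain ⟨hji, hjT⟩ := Finset.mem_erase.1 hj
    by_cases hj0 : t j = 0
    · simpa [hj0] using norm_pos_iff.1 hpos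
    · by_contra hlt
      have h1 := hcon i hi j hjT hji.symm (norm_pos_iff.1 hpos) hj0 (not_lt.1 hlt)
      have h2 := hmax j hjT
      nlinarith
  rw [← Finset.add_sum_erase _ _ hi, add_eq_zero_iff_eq_neg] at hsum
  have h1 : ‖t i‖ ≤ ∑ j ∈ T.erase i, ‖t j‖ := by
    conv_lhs => rw [hsum, norm_neg]
    exact norm_sum_le _ _
  have h2 : ∑ j ∈ T.erase i, T.card * ‖t j‖ ≤ (T.erase i).card • ‖t i‖ :=
    Finset.sum_le_card_nsmul _ _ _ fun j hj => (hsmall j hj).le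
  rw [← Finset.mul_sum, nsmul_eq_mul, Finset.card_erase_of_mem hi,
    Nat.cast_sub (Finset.card_pos.2 ⟨i, hi⟩)] at h2
  push_cast at h2
  nlinarith

theorem exists_gap_and_bound (T : Finset ℂ) (hT : ∀ μ ∈ T, ∀ ν ∈ T, μ ≠ ν → μ.re ≠ ν.re) :
    ∃ g M : ℝ, 0 < g ∧ 0 ≤ M ∧ ∀ μ ∈ T, ∀ ν ∈ T, μ ≠ ν →
      g ≤ |μ.re - ν.re| ∧ |μ.im - ν.im| ≤ M := by
  obtain ⟨A, hA⟩ := ((T ×ˢ T).image fun x : ℂ × ℂ => |x.1.re - x.2.re|⁻¹).exists_le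
  obtain ⟨M, hM⟩ := ((T ×ˢ T).image fun x : ℂ × ℂ => |x.1.im - x.2.im|).exists_le
  refine ⟨(max A 1)⁻¹, max M 0, by positivity, le_max_right _ _, fun μ hμ ν hν hne => ⟨?_, ?_⟩⟩
  · have h1 := hA _ (Finset.mem_image_of_mem _ (Finset.mk_mem_product hμ hν))
    have h2 : 0 < |μ.re - ν.re| := abs_pos.2 (sub_ne_zero.2 (hT μ hμ ν hν hne))
    exact inv_le_of_inv_le₀ h2 (h1.trans (le_max_left _ _))
  · exact (hM _ (Finset.mem_image_of_mem _ (Finset.mk_mem_product hμ hν))).trans (le_max_left _ _)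

/-- The zeros in a strip of an exponential polynomial lie in boundedly many rectangles of bounded
width. -/
theorem exists_cover_zeros (T : Finset ℂ) (hT : ∀ μ ∈ T, ∀ ν ∈ T, μ ≠ ν → μ.re ≠ ν.re) (k : ℕ)
    (α : ℝ) :
    ∃ D, 0 ≤ D ∧ ∀ P : ℂ → ℂ[X], (∀ μ, (P μ).natDegree ≤ k) → (∃ μ ∈ T, P μ ≠ 0) →
      ∃ b : (T × Fin k) ⊕ (T × T) → ℝ, ∀ ζ ∈ horizontalStrip α,
        ∑ μ ∈ T, (P μ).eval ζ * Complex.exp (μ * ζ) = 0 → ∃ i, |ζ.re - b i| ≤ D := by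
  classical
  obtain ⟨g, M, hg, hM0, hgM⟩ := exists_gap_and_bound T hT
  set δ := 4 * (k + 1) / g with hδ
  have hδ0 : 0 < δ := by positivity
  set H := 2 / g * (2 * α * M + 2 * Real.log T.card + g * α) with hH
  refine ⟨max δ H, hδ0.le.trans (le_max_left _ _), fun P hP hne => ?_⟩
  let good : T × T → ℂ → Prop := fun x ζ => ζ ∈ horizontalStrip α ∧ x.1 ≠ x.2 ∧
    (∀ w ∈ (P x.1).roots, δ ≤ ‖ζ - w‖) ∧ (∀ w ∈ (P x.2).roots, δ ≤ ‖ζ - w‖) ∧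
    (P x.1).eval ζ ≠ 0 ∧ (P x.2).eval ζ ≠ 0 ∧
    ‖(P x.1).eval ζ * Complex.exp (x.1 * ζ)‖ ≤
      T.card * ‖(P x.2).eval ζ * Complex.exp (x.2 * ζ)‖ ∧
    ‖(P x.2).eval ζ * Complex.exp (x.2 * ζ)‖ ≤
      T.card * ‖(P x.1).eval ζ * Complex.exp (x.1 * ζ)‖
  have hclose : ∀ x, ∃ b : ℝ, ∀ ζ, good x ζ → |ζ.re - b| ≤ H := by
    intro x
    by_cases hx : ∃ ζ, good x ζ
    · obtain ⟨ζ, h1, h2, h3, h4, h5, h6, h7, h8⟩ := hx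
      refine ⟨ζ.re, fun ζ' ⟨h1', _, h3', h4', h5', h6', h7', h8'⟩ => ?_⟩
      obtain ⟨hg', hM'⟩ := hgM x.1 x.1.2 x.2 x.2.2 (fun h => h2 (Subtype.ext h))
      have hK : (1 : ℝ) ≤ T.card := by exact_mod_cast Finset.card_pos.2 ⟨x.1.1, x.1.2⟩
      exact abs_re_sub_le_of_comparable (hP _) (hP _) hg hg' hM' hK h1 h1' h3 h4 h3' h4'
        h5 h6 h5' h6' h7 h8 h7' h8'
    · exact ⟨0, fun ζ hζ => absurd ⟨ζ, hζ⟩ hx⟩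
  choose b₂ hb₂ using hclose
  -- Windows of the first kind are centred at the at most k roots of each P μ, the default 0 padding
  -- shorter lists; those of the second kind belong to pairs of comparable terms.
  refine ⟨Sum.elim (fun x => ((P x.1).roots.toList.getD x.2 0).re) b₂, fun ζ hζ h0 => ?_⟩
  by_cases hnear : ∃ μ ∈ T, ∃ w ∈ (P μ).roots, ‖ζ - w‖ < δ
  · obtain ⟨μ, hμ, w, hw, hlt⟩ := hnear
    obtain ⟨n, hn, rfl⟩ := List.mem_iff_getElem.1 (Multiset.mem_toList.2 hw)
    have hnk : n < k := by
      rw [Multiset.length_toList] at hn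
      exact hn.trans_le ((card_roots' _).trans (hP μ))
    refine ⟨Sum.inl (⟨μ, hμ⟩, ⟨n, hnk⟩), ?_⟩
    simp only [Sum.elim_inl, List.getD_eq_getElem _ _ hn]
    refine le_trans ?_ (hlt.le.trans (le_max_left _ _))
    rw [← Complex.sub_re]
    exact Complex.abs_re_le_norm _
  · push Not at hnear
    obtain ⟨μ, hμ, hPμ⟩ := hne
    have hμ0 : (P μ).eval ζ * Complex.exp (μ * ζ) ≠ 0 := by
      refine mul_ne_zero (fun hev => ?_) (Complex.exp_ne_zero _)
      have := hnear μ hμ ζ ((mem_roots hPμ).2 hev)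
      rw [sub_self, norm_zero] at this
      exact this.not_gt hδ0
    obtain ⟨i, hi, j, hj, hij, hi0, hj0, h1, h2⟩ :=
      exists_comparable_of_sum_eq_zero T _ ⟨μ, hμ, hμ0⟩ h0
    refine ⟨Sum.inr (⟨i, hi⟩, ⟨j, hj⟩), (hb₂ (⟨i, hi⟩, ⟨j, hj⟩) ζ ⟨hζ, ?_, hnear i hi, hnear j hj,
      left_ne_zero_of_mul hi0, left_ne_zero_of_mul hj0, h1, h2⟩).trans (le_max_right _ _)⟩
    exact fun h => hij (congrArg Subtype.val h)

end MultipleRoots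

/-! ### Uniform and explicit bounds for solutions. -/

section ZeroBounds

variable {k : ℕ} {a : Fin (k + 1) → ℂ}

theorem exists_zeroCount_le {α : ℝ} (hα : 0 ≤ α) (ha : a (Fin.last k) ≠ 0)
    (hroots : ∀ μ ∈ (odeCharPoly a).roots, ∀ ν ∈ (odeCharPoly a).roots, μ ≠ ν → μ.re ≠ ν.re) :
    ∃ N : ℕ, ∀ y : ℂ → ℂ, IsODESolution a y → y ≠ 0 →
      zeroCount y (horizontalStrip α) ≤ (N : ℕ∞) := by
  classical
  set l := (odeCharPoly a).roots.toList with hl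
  have hl' : (l : Multiset ℂ) = (odeCharPoly a).roots := Multiset.coe_toList _
  set T := (odeCharPoly a).roots.toFinset with hT
  obtain ⟨D, hD, hcov⟩ := exists_cover_zeros T (fun μ hμ ν hν => hroots μ
    (Multiset.mem_toFinset.1 hμ) ν (Multiset.mem_toFinset.1 hν)) k α
  refine ⟨⌈Fintype.card ((T × Fin k) ⊕ (T × T)) *
    ((l.length : ℝ) - 1 + 2 / Real.pi * (α + D) * polygonalLength l)⌉₊, fun y hy hne => ?_⟩
  have happ := applyFactors_eq_zero_of_isODESolution ha hy hl'
  obtain ⟨P, hP, hsum⟩ := exists_eq_sum_eval_mul_exp T l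
    (fun μ hμ => Multiset.mem_toFinset.2 (Multiset.mem_toList.1 hμ)) hy.1 happ
  have hlen : l.length = k := by
    rw [← Multiset.coe_card, hl', card_roots_odeCharPoly ha]
  obtain ⟨b, hb⟩ := hcov P (fun μ => natDegree_le_of_degree_le ((hP μ).le.trans (by
    exact_mod_cast List.count_le_length.trans hlen.le))) (by
      by_contra hcon
      push Not at hcon
      refine hne (funext fun z => ?_)
      rw [hsum z]
      exact Finset.sum_eq_zero fun μ hμ => by simp [hcon μ hμ])
  refine zeroCount_le_of_forall_sum_le hy.1 hne fun S hS => ?_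
  have := sum_order_le_of_cover hy.1 hne happ hα hD (b := b)
    (fun ζ hζ h0 => hb ζ hζ (by rw [← hsum ζ, h0])) hS
  exact_mod_cast this.trans (Nat.le_ceil _)

/-- Each root occurs at most once in the list, so its polynomial coefficient has degree < 1 and is
constant. -/
theorem exists_eq_sum_mul_exp_of_simple (ha : a (Fin.last k) ≠ 0) {lam : Fin k → ℂ}
    (hr : (odeCharPoly a).roots = Multiset.map lam Finset.univ.val)
    (hinj : Function.Injective lam) {y : ℂ → ℂ} (hy : IsODESolution a y) :
    ∃ c : Fin k → ℂ, ∀ z, y z = ∑ j, c j * Complex.exp (lam j * z) := by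
  classical
  have hl : ((odeCharPoly a).roots.toList : Multiset ℂ) = (odeCharPoly a).roots :=
    Multiset.coe_toList _
  have hnd : (odeCharPoly a).roots.toList.Nodup := by
    rw [← Multiset.coe_nodup, hl, hr]
    exact Multiset.Nodup.map hinj Finset.univ.nodup
  obtain ⟨P, hP, hsum⟩ := exists_eq_sum_eval_mul_exp (Finset.univ.image lam)
    (odeCharPoly a).roots.toList (fun μ hμ => by
      rw [Multiset.mem_toList, hr] at hμ
      simpa using hμ) hy.1 (applyFactors_eq_zero_of_isODESolution ha hy hl)
  refine ⟨fun j => (P (lam j)).coeff 0, fun z => ?_⟩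
  rw [hsum z, Finset.sum_image fun i _ j _ h => hinj h]
  refine Finset.sum_congr rfl fun j _ => ?_
  have hdeg : (P (lam j)).degree < 1 := (hP (lam j)).trans_le (by
    exact_mod_cast List.nodup_iff_count_le_one.1 hnd (lam j))
  have : P (lam j) = C ((P (lam j)).coeff 0) :=
    eq_C_of_degree_le_zero (Nat.WithBot.lt_one_iff_le_zero.1 hdeg)
  conv_lhs => rw [this, eval_C]

theorem sum_order_le_of_simple {α : ℝ} (hα : 0 ≤ α) (ha : a (Fin.last k) ≠ 0) {lam : Fin k → ℂ}
    (hr : (odeCharPoly a).roots = Multiset.map lam Finset.univ.val)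
    (hlam : StrictMono fun j => (lam j).re) {y : ℂ → ℂ} (hy : IsODESolution a y) (hne : y ≠ 0)
    {S : Finset ℂ} (hS : (S : Set ℂ) ⊆ horizontalStrip α) :
    ((∑ z ∈ S, analyticOrderNatAt y z : ℕ) : ℝ) ≤ ((k : ℝ) - 1) ^ 2 +
      2 / Real.pi * ((k : ℝ) - 1) * shortestPathLength {μ | μ ∈ (odeCharPoly a).roots} *
        (α * (rootXi lam + 2) + rootTheta lam * Real.log 4) := by
  have hinj : Function.Injective lam := fun i j h => hlam.injective (by simp only [h])
  obtain ⟨c, hc⟩ := exists_eq_sum_mul_exp_of_simple ha hr hinj hy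
  have hc0 : ∃ j, c j ≠ 0 := by
    by_contra hcon
    push Not at hcon
    exact hne (funext fun z => by simp [hc z, hcon])
  have hk : 1 ≤ k := by
    obtain ⟨j, -⟩ := hc0
    have := j.2
    omega
  obtain ⟨b, hb⟩ := exists_cover_zeros_of_simple hlam hc0 α
  set D := α * rootXi lam + rootTheta lam * Real.log 4 with hD
  have hX := rootXi_nonneg lam
  have hΘ := rootTheta_nonneg lam
  have hlog : 0 ≤ Real.log 4 := Real.log_nonneg (by norm_num)
  have hD0 : 0 ≤ D := by positivity
  have hnd : (odeCharPoly a).roots.Nodup := by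
    rw [hr]
    exact Multiset.Nodup.map hinj Finset.univ.nodup
  set L := shortestPathLength {μ | μ ∈ (odeCharPoly a).roots} with hL
  have hL0 : 0 ≤ L := shortestPathLength_nonneg _
  have hk1 : ((k - 1 : ℕ) : ℝ) = (k : ℝ) - 1 := by rw [Nat.cast_sub hk, Nat.cast_one]
  have hk0 : 0 ≤ (k : ℝ) - 1 := by rw [← hk1]; positivity
  -- There are k - 1 windows, each with the same rectangle bound, and the roots are ordered along a
  -- path within ε of the shortest length.
  have key : ∀ ε > 0, ((∑ z ∈ S, analyticOrderNatAt y z : ℕ) : ℝ) ≤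
      ((k : ℝ) - 1) * ((k : ℝ) - 1 + 2 / Real.pi * (α + D) * (L + ε)) := by
    intro ε hε
    obtain ⟨l, hl, hlen⟩ := exists_list_polygonalLength_lt hnd hε
    have h1 := sum_order_le_of_cover hy.1 hne (applyFactors_eq_zero_of_isODESolution ha hy hl)
      hα hD0 (b := b) (fun ζ hζ h0 => hb ζ hζ (by rw [← hc ζ, h0])) hS
    have hlk : l.length = k := by rw [← Multiset.coe_card, hl, card_roots_odeCharPoly ha]
    rw [Fintype.card_fin, hk1, hlk] at h1
    refine h1.trans ?_
    gcongr
  have key2 : ((∑ z ∈ S, analyticOrderNatAt y z : ℕ) : ℝ) ≤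
      ((k : ℝ) - 1) * ((k : ℝ) - 1 + 2 / Real.pi * (α + D) * (L + 0)) := by
    have hcont : Filter.Tendsto (fun ε : ℝ =>
        ((k : ℝ) - 1) * ((k : ℝ) - 1 + 2 / Real.pi * (α + D) * (L + ε)))
        (nhdsWithin 0 (Set.Ioi 0))
        (nhds (((k : ℝ) - 1) * ((k : ℝ) - 1 + 2 / Real.pi * (α + D) * (L + 0)))) :=
      (Continuous.tendsto (by fun_prop) 0).mono_left nhdsWithin_le_nhds
    exact ge_of_tendsto hcont (by filter_upwards [self_mem_nhdsWithin] with ε hε using key ε hε)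
  refine key2.trans ?_
  have h3 : α + D ≤ α * (rootXi lam + 2) + rootTheta lam * Real.log 4 := by
    rw [hD]
    linarith
  calc _ = ((k : ℝ) - 1) ^ 2 + 2 / Real.pi * ((k : ℝ) - 1) * L * (α + D) := by ring
    _ ≤ _ := by gcongr

end ZeroBounds

theorem proposition1 (α : ℝ) (hα : 0 ≤ α) (k : ℕ) (a : Fin (k + 1) → ℂ) (ha : a (Fin.last k) ≠ 0)
    (hroots : ∀ μ ∈ (odeCharPoly a).roots, ∀ ν ∈ (odeCharPoly a).roots, μ ≠ ν → μ.re ≠ ν.re) :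
    ∃ N : ℕ,
      (∀ y : ℂ → ℂ, IsODESolution a y → y ≠ 0 → zeroCount y (horizontalStrip α) ≤ (N : ℕ∞)) ∧
      (∀ lam : Fin k → ℂ,
        (odeCharPoly a).roots = Multiset.map lam Finset.univ.val →
        StrictMono (fun j => (lam j).re) →
        (N : ℝ) ≤ ((k : ℝ) - 1) ^ 2 +
          2 / Real.pi * ((k : ℝ) - 1) * shortestPathLength {μ | μ ∈ (odeCharPoly a).roots} *
            (α * (rootXi lam + 2) + rootTheta lam * Real.log 4)) := by
  classical
  have hex := exists_zeroCount_le hα ha hroots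
  -- Taking the least uniform bound reduces the second property to showing that the integer part of
  -- the explicit expression is also a uniform bound.
  refine ⟨Nat.find hex, Nat.find_spec hex, fun lam hr hlam => ?_⟩
  set B := ((k : ℝ) - 1) ^ 2 +
    2 / Real.pi * ((k : ℝ) - 1) * shortestPathLength {μ | μ ∈ (odeCharPoly a).roots} *
      (α * (rootXi lam + 2) + rootTheta lam * Real.log 4) with hB
  have hB0 : 0 ≤ B := by
    -- For k = 0 the factor k - 1 is -1, but the path length vanishes and the expression equals 1.
    rcases Nat.eq_zero_or_pos k with rfl | hk
    · have h0 : shortestPathLength {μ | μ ∈ (odeCharPoly a).roots} ≤ 0 := by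
        refine csInf_le ⟨0, ?_⟩ ⟨[], ?_, rfl⟩
        · rintro _ ⟨p, -, rfl⟩
          exact polygonalLength_nonneg p
        · rw [hr]
          simp
      rw [hB, le_antisymm h0 (shortestPathLength_nonneg _)]
      norm_num
    · have h1 : (1 : ℝ) ≤ k := by exact_mod_cast hk
      have h2 : 0 ≤ (k : ℝ) - 1 := by linarith
      have h3 := rootXi_nonneg lam
      have h4 := rootTheta_nonneg lam
      have h5 := shortestPathLength_nonneg {μ | μ ∈ (odeCharPoly a).roots}
      have h6 : 0 ≤ Real.log 4 := Real.log_nonneg (by norm_num)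
      positivity
  refine le_trans ?_ (Nat.floor_le hB0)
  refine Nat.cast_le.2 (Nat.find_min' hex fun y hy hne => ?_)
  refine zeroCount_le_of_forall_sum_le hy.1 hne fun S hS => ?_
  exact Nat.le_floor (sum_order_le_of_simple hα ha hr hlam hy hne hS)
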